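/- Let $G$ be a compact (Hausdorff) group and let $\widehat G$ be the set of unitary equivalence classes of continuous irreducible unitary representations $\pi:G\to\mathcal U(\mathcal H_\pi)$, with $d_\pi=\dim\mathcal H_\pi<\infty$; fix a representative $\pi$ of each class. For unitary representations write $\sigma\subset\rho$ if $\sigma$ is unitarily equivalent to a subrepresentation of $\rho$. Let $\omega:\widehat G\to(0,\infty)$ be * a weight: $\omega(\sigma)\le\omega(\pi)\,\omega(\pi')$ whenever $\sigma,\pi,\pi'\in\widehat G$ and $\sigma\subset\pi\otimes\pi'$; * symmetric: $\omega(\bar\pi)=\omega(\pi)$ for all $\pi\in\widehat G$, where $\bar\pi(s)=\pi(s^{-1})^{t}$ is the conjugate representation; * nonexponential: for every $\pi\in\widehat G$, $$\lim_{n\to\infty}\omega(\pi^{\otimes n})^{1/n}=1,\qquad\text{where }\ \omega(\rho)=\sup\{\omega(\sigma):\sigma\in\widehat G,\ \sigma\subset\rho\}.$$ Let $A_\omega(G)$ be the Beurling--Fourier algebra of $\omega$, that is, the set of continuous functions on $G$ of the form $$u(s)=\sum_{\pi\in\widehat G}d_\pi\operatorname{Tr}\bigl(\hat u(\pi)\pi(s)\bigr)\quad(s\in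 G),\qquad \hat u(\pi)\in\mathcal L(\mathcal H_\pi),\qquad \sum_{\pi\in\widehat G}\|\hat u(\pi)\|_1\,d_\pi\,\omega(\pi)<\infty,$$ where $\|\cdot\|_1$ is the trace norm. Then $A_\omega(G)$ is a unital subalgebra of $C(G)$ under pointwise operations, and its Gelfand spectrum $G_\omega$ (the set of nonzero multiplicative linear functionals $A_\omega(G)\to\mathbb C$, with the topology of pointwise convergence) is exactly $G$: $G_\omega$ is the set of evaluations $u\mapsto u(s)$, $s\in G$, and the map sending $s$ to the evaluation at $s$ is a homeomorphism of $G$ onto $G_\omega$. -/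

import Mathlib

open Filter Topology
open scoped Kronecker

namespace BeurlingFourier

section Representations

variable {G : Type*} [Group G] [TopologicalSpace G]

/-- Continuous unitary representations of `G` on the Hilbert space `ℂ^ι` (`ι` finite). -/
abbrev URep (G : Type*) [Group G] [TopologicalSpace G] (ι : Type*) [Fintype ι] [DecidableEq ι] :=
  G →ₜ* Matrix.unitaryGroup ι ℂ

/-- The underlying linear representation on `ι → ℂ`. -/
noncomputable def URep.toRepresentation {ι : Type*} [Fintype ι] [DecidableEq ι] (ρ : URep G ι) :
    Representation ℂ G (ι → ℂ) where
  toFun s := Matrix.toLin' (ρ s : Matrix ι ι ℂ)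
  map_one' := by simp [Module.End.one_eq_id]
  map_mul' s t := by simp [Matrix.toLin'_mul, Module.End.mul_eq_comp]

/-- `σ ⊂ ρ`: `σ` is unitarily equivalent to a subrepresentation of `ρ`, that is, there is an
isometry `V` intertwining `σ` and `ρ`. -/
def URep.Sub {ι κ : Type*} [Fintype ι] [DecidableEq ι] [Fintype κ] [DecidableEq κ]
    (σ : URep G ι) (ρ : URep G κ) : Prop :=
  ∃ V : Matrix κ ι ℂ, V.conjTranspose * V = 1 ∧
    ∀ s : G, (ρ s : Matrix κ κ ℂ) * V = V * (σ s : Matrix ι ι ℂ)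

/-- Unitary equivalence of two representations. -/
def URep.Equiv {ι κ : Type*} [Fintype ι] [DecidableEq ι] [Fintype κ] [DecidableEq κ]
    (σ : URep G ι) (ρ : URep G κ) : Prop :=
  ∃ V : Matrix κ ι ℂ, V.conjTranspose * V = 1 ∧ V * V.conjTranspose = 1 ∧
    ∀ s : G, (ρ s : Matrix κ κ ℂ) * V = V * (σ s : Matrix ι ι ℂ)

/-- The tensor product `π ⊗ π'`, with matrices the Kronecker products. -/
noncomputable def URep.tensor {ι κ : Type*} [Fintype ι] [DecidableEq ι] [Fintype κ] [DecidableEq κ]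
    (ρ : URep G ι) (τ : URep G κ) : URep G (ι × κ) where
  toFun s := ⟨(ρ s : Matrix ι ι ℂ) ⊗ₖ (τ s : Matrix κ κ ℂ),
    Matrix.kronecker_mem_unitary (ρ s).2 (τ s).2⟩
  map_one' := by
    apply Subtype.ext
    simp
  map_mul' s t := by
    apply Subtype.ext
    simp [Matrix.mul_kronecker_mul]
  continuous_toFun := by
    refine Continuous.subtype_mk (continuous_matrix fun i j => ?_) _
    have h1 : Continuous fun s => (ρ s : Matrix ι ι ℂ) :=
      continuous_subtype_val.comp ρ.continuous_toFun
    have h2 : Continuous fun s => (τ s : Matrix κ κ ℂ) :=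
      continuous_subtype_val.comp τ.continuous_toFun
    exact (h1.matrix_elem i.1 j.1).mul (h2.matrix_elem i.2 j.2)

/-- The matrix of the `k`-fold tensor power of a linear map of `ℂ^ι` with matrix `M`, in the basis
`e_{i 1} ⊗ ⋯ ⊗ e_{i k}`. -/
def tensorPowMatrix {ι : Type*} (k : ℕ) (M : Matrix ι ι ℂ) : Matrix (Fin k → ι) (Fin k → ι) ℂ :=
  Matrix.of fun i j => ∏ l, M (i l) (j l)

theorem tensorPowMatrix_mul {ι : Type*} [Fintype ι] [DecidableEq ι] (k : ℕ) (M N : Matrix ι ι ℂ) :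
    tensorPowMatrix k (M * N) = tensorPowMatrix k M * tensorPowMatrix k N := by
  ext i j
  simp only [tensorPowMatrix, Matrix.of_apply, Matrix.mul_apply, ← Finset.prod_mul_distrib]
  rw [Finset.prod_univ_sum, Fintype.piFinset_univ]

theorem tensorPowMatrix_one {ι : Type*} [Fintype ι] [DecidableEq ι] (k : ℕ) :
    tensorPowMatrix k (1 : Matrix ι ι ℂ) = 1 := by
  ext i j
  simp only [tensorPowMatrix, Matrix.of_apply, Matrix.one_apply]
  by_cases h : i = j
  · simp [h]
  · obtain ⟨l, hl⟩ := Function.ne_iff.mp h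
    rw [if_neg h]
    exact Finset.prod_eq_zero (Finset.mem_univ l) (if_neg hl)

theorem tensorPowMatrix_star {ι : Type*} (k : ℕ) (M : Matrix ι ι ℂ) :
    star (tensorPowMatrix k M) = tensorPowMatrix k (star M) := by
  ext i j
  simp [tensorPowMatrix, Matrix.star_apply]

/-- The tensor power `ρ^{⊗ k}`. -/
noncomputable def URep.tensorPow {ι : Type*} [Fintype ι] [DecidableEq ι] (ρ : URep G ι) (k : ℕ) :
    URep G (Fin k → ι) where
  toFun s := ⟨tensorPowMatrix k (ρ s : Matrix ι ι ℂ), by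
    rw [Matrix.mem_unitaryGroup_iff, tensorPowMatrix_star, ← tensorPowMatrix_mul,
      Matrix.mem_unitaryGroup_iff.mp (ρ s).2, tensorPowMatrix_one]⟩
  map_one' := by
    apply Subtype.ext
    simp [tensorPowMatrix_one]
  map_mul' s t := by
    apply Subtype.ext
    simp [tensorPowMatrix_mul]
  continuous_toFun := by
    refine Continuous.subtype_mk (continuous_matrix fun i j => ?_) _
    have h1 : Continuous fun s => (ρ s : Matrix ι ι ℂ) :=
      continuous_subtype_val.comp ρ.continuous_toFun
    simp only [tensorPowMatrix, Matrix.of_apply]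
    exact continuous_finsetProd _ fun l _ => h1.matrix_elem (i l) (j l)

/-- The conjugate representation `π̄(s) = π(s⁻¹)ᵗ`, on the dual space in the dual basis. -/
noncomputable def URep.conj [IsTopologicalGroup G] {ι : Type*} [Fintype ι] [DecidableEq ι] (ρ : URep G ι) :
    URep G ι where
  toFun s := ⟨(ρ s⁻¹ : Matrix ι ι ℂ).transpose,
    Matrix.transpose_mem_unitaryGroup_iff.mpr (ρ s⁻¹).2⟩
  map_one' := by
    apply Subtype.ext
    simp
  map_mul' s t := by
    apply Subtype.ext
    simp only [mul_inv_rev, map_mul, Matrix.UnitaryGroup.mul_val, Matrix.transpose_mul]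
  continuous_toFun := by
    refine Continuous.subtype_mk ?_ _
    have h1 : Continuous fun s => (ρ s : Matrix ι ι ℂ) :=
      continuous_subtype_val.comp ρ.continuous_toFun
    exact (h1.comp continuous_inv).matrix_transpose

theorem URep.Equiv.refl {ι : Type*} [Fintype ι] [DecidableEq ι] (σ : URep G ι) :
    URep.Equiv σ σ := ⟨1, by simp, by simp, by simp⟩

theorem URep.Equiv.symm {ι κ : Type*} [Fintype ι] [DecidableEq ι] [Fintype κ] [DecidableEq κ]
    {σ : URep G ι} {ρ : URep G κ} : URep.Equiv σ ρ → URep.Equiv ρ σ := by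
  rintro ⟨V, h1, h2, h3⟩
  refine ⟨V.conjTranspose, by simpa using h2, by simpa using h1, fun s => ?_⟩
  calc (σ s : Matrix ι ι ℂ) * V.conjTranspose
      = V.conjTranspose * V * (σ s : Matrix ι ι ℂ) * V.conjTranspose := by rw [h1, one_mul]
    _ = V.conjTranspose * ((ρ s : Matrix κ κ ℂ) * V) * V.conjTranspose := by
        rw [h3 s, Matrix.mul_assoc V.conjTranspose V]
    _ = V.conjTranspose * (ρ s : Matrix κ κ ℂ) * (V * V.conjTranspose) := by
        simp only [Matrix.mul_assoc]
    _ = V.conjTranspose * (ρ s : Matrix κ κ ℂ) := by rw [h2, Matrix.mul_one]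

theorem URep.Equiv.trans {ι κ μ : Type*} [Fintype ι] [DecidableEq ι] [Fintype κ] [DecidableEq κ]
    [Fintype μ] [DecidableEq μ] {σ : URep G ι} {ρ : URep G κ} {τ : URep G μ} :
    URep.Equiv σ ρ → URep.Equiv ρ τ → URep.Equiv σ τ := by
  rintro ⟨V, h1, h2, h3⟩ ⟨W, k1, k2, k3⟩
  refine ⟨W * V, ?_, ?_, fun s => ?_⟩
  · rw [Matrix.conjTranspose_mul, Matrix.mul_assoc, ← Matrix.mul_assoc W.conjTranspose, k1,
      Matrix.one_mul, h1]
  · rw [Matrix.conjTranspose_mul, Matrix.mul_assoc, ← Matrix.mul_assoc V, h2,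
      Matrix.one_mul, k2]
  · rw [← Matrix.mul_assoc, k3, Matrix.mul_assoc, h3, Matrix.mul_assoc]

end Representations

/-- An irreducible continuous unitary representation of `G` on some `ℂ^n`, `n ≥ 1`. Irreducible
unitary representations of compact groups are finite-dimensional, so that up to unitary equivalence
these are all of them. -/
structure Irrep (G : Type*) [Group G] [TopologicalSpace G] where
  dim : ℕ
  rep : URep G (Fin dim)
  irreducible : rep.toRepresentation.IsIrreducible

/-- Unitary equivalence of irreducible representations. -/
instance irrepSetoid (G : Type*) [Group G] [TopologicalSpace G] : Setoid (Irrep G) where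
  r π σ := URep.Equiv π.rep σ.rep
  iseqv := ⟨fun π => URep.Equiv.refl π.rep, URep.Equiv.symm, URep.Equiv.trans⟩

/-- The dual object `Ĝ`: unitary equivalence classes of irreducible representations. -/
def Dual (G : Type*) [Group G] [TopologicalSpace G] := Quotient (irrepSetoid G)

variable {G : Type*} [Group G] [TopologicalSpace G]

/-- The dimension `d_π` of (a fixed representative of) `π ∈ Ĝ`. -/
noncomputable def Dual.dim (π : Dual G) : ℕ := (Quotient.out π).dim

/-- A fixed representative of `π ∈ Ĝ`. -/
noncomputable def Dual.rep (π : Dual G) : URep G (Fin π.dim) := (Quotient.out π).rep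

/-- A weight on `Ĝ`: `ω > 0` and `ω(σ) ≤ ω(π) ω(π')` whenever `σ ⊂ π ⊗ π'`. -/
def IsWeight (ω : Dual G → ℝ) : Prop :=
  (∀ π, 0 < ω π) ∧
    ∀ σ π π' : Dual G, σ.rep.Sub (π.rep.tensor π'.rep) → ω σ ≤ ω π * ω π'

/-- `ω` is symmetric if `ω(π̄) = ω(π)` for all `π ∈ Ĝ`; here `σ` is the class of `π̄`. -/
def IsSymmetricWeight [IsTopologicalGroup G] (ω : Dual G → ℝ) : Prop :=
  ∀ π σ : Dual G, σ.rep.Equiv π.rep.conj → ω σ = ω π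

/-- `ω(ρ) = sup {ω(σ) : σ ∈ Ĝ, σ ⊂ ρ}` for a finite-dimensional unitary representation `ρ`
(only finitely many `σ` occur). -/
noncomputable def weightOf {ι : Type*} [Fintype ι] [DecidableEq ι] (ω : Dual G → ℝ)
    (ρ : URep G ι) : ℝ :=
  sSup (ω '' {σ : Dual G | σ.rep.Sub ρ})

/-- `ω` is nonexponential if `lim_n ω(π^{⊗ n})^{1/n} = 1` for every `π ∈ Ĝ`. -/
def IsNonexponential (ω : Dual G → ℝ) : Prop :=
  ∀ π : Dual G,
    Tendsto (fun n : ℕ => weightOf ω (π.rep.tensorPow n) ^ (1 / (n : ℝ))) atTop (𝓝 1)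

/-- The trace norm `‖A‖₁ = Tr |A|`, the sum of the singular values. -/
noncomputable def traceNorm {n : ℕ} (A : Matrix (Fin n) (Fin n) ℂ) : ℝ :=
  ∑ i ∈ Finset.range n, (Matrix.toEuclideanLin A).singularValues i

/-- The functions in the Beurling–Fourier algebra `A_ω(G)`, for `ω` bounded away from zero (as
symmetric weights are): the sums `u(s) = ∑_π d_π Tr(û(π) π(s))` of the operator fields
`(û(π))_π ∈ ∏_π L(H_π)` with `‖u‖_ω = ∑_π ‖û(π)‖₁ d_π ω(π) < ∞`. The field is determined by the
function, `û(π) = ∫ u(s) π(s⁻¹) ds`, by the orthogonality relations. -/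
def beurlingFourierSet (ω : Dual G → ℝ) : Set C(G, ℂ) :=
  {u | ∃ f : (π : Dual G) → Matrix (Fin π.dim) (Fin π.dim) ℂ,
    Summable (fun π => traceNorm (f π) * (π.dim : ℝ) * ω π) ∧
    ∀ s : G, HasSum
      (fun π => (π.dim : ℂ) * Matrix.trace (f π * (π.rep s : Matrix (Fin π.dim) (Fin π.dim) ℂ)))
      (u s)}

/-- The Gelfand spectrum of a commutative complex algebra `A`: the nonzero multiplicative linear
functionals, as a subset of `A → ℂ`, whose product topology induces the Gelfand topology. If `A`
is a Banach algebra for some norm, these functionals are automatically continuous. -/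
def gelfandSpectrum (A : Type*) [CommRing A] [Algebra ℂ A] : Set (A → ℂ) :=
  {χ | ∃ φ : A →ₙₐ[ℂ] ℂ, φ ≠ 0 ∧ χ = φ}

/-- The point of `A → ℂ` given by `s ∈ G`: evaluation at `s` of the functions in `A`. -/
noncomputable def evalAt (A : Subalgebra ℂ C(G, ℂ)) (s : G) : A → ℂ := fun u => (u : C(G, ℂ)) s

end BeurlingFourier

/-! Membership in the algebra is measured by the gauge `NormLE`: absolutely convergent sums of
coefficients ⟨π(s)x, y⟩, each costing ‖x‖‖y‖ω(π). Singular value decomposition shows that these are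
the functions given by the trace-norm series (`mem_beurlingFourierSet_iff`). A product of
coefficients is a coefficient of a tensor product, and splitting a representation into irreducibles
does not raise the cost, so the weight inequality makes the gauge submultiplicative (`NormLE.mul`).
A symmetric weight is at least 1, hence the gauge dominates the sup norm.

Let ψ be a character. Neumann series give |ψ(u)| ≤ C whenever u has gauge at most C
(`norm_character_le`). If u is a coefficient of π, then uⁿ is a coefficient of π^{⊗n}, so |ψ(u)|ⁿ ≤
(‖x‖‖y‖)ⁿ ω(π^{⊗n}). Taking n-th roots, nonexponentiality makes the matrix (ψ(π_{ij})) a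
contraction. Its inverse is the transpose of the matrix of values of ψ at the conjugated entries,
which belong to π̄; it is a contraction for the same reason. So the matrix is unitary, and ψ
commutes with complex conjugation (`character_starA`).

Suppose that ψ is no point evaluation. Then the functions equal to u on one copy of G and to t ↦
ψ(u(· t)) on a second copy form a self-adjoint unital algebra separating the points of G ⊔ G, dense
by Stone–Weierstrass. But by invariance of Haar measure both halves have the same integral
(`integral_character_translateA`), so the function 0 on one copy and 1 on the other cannot be
approximated. This is a contradiction.

Separation of points of G by irreducible representations, the part of Peter–Weyl needed here, comes
from the spectral theorem for a compact operator commuting with translations. The topological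
statement is then compactness of G. -/

namespace BeurlingFourier

universe u

/-! ### Euclidean norms of vectors, tensors and orthogonal components. -/

section EuclideanNorm

variable {ι κ μ : Type*} [Fintype ι] [Fintype κ] [Fintype μ]

/-- The Euclidean norm of a vector in `ℂ^ι`. -/
noncomputable def l2 (x : ι → ℂ) : ℝ := ‖WithLp.toLp 2 x‖

theorem l2_nonneg (x : ι → ℂ) : 0 ≤ l2 x := norm_nonneg _

theorem l2_sq (x : ι → ℂ) : l2 x ^ 2 = ∑ i, ‖x i‖ ^ 2 := by
  simp [l2, EuclideanSpace.norm_sq_eq]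

theorem l2_eq_of_sq {x : ι → ℂ} {r : ℝ} (hr : 0 ≤ r) (h : l2 x ^ 2 = r ^ 2) : l2 x = r :=
  (sq_eq_sq₀ (l2_nonneg x) hr).mp h

theorem l2_smul (c : ℂ) (x : ι → ℂ) : l2 (c • x) = ‖c‖ * l2 x := by
  simp [l2, norm_smul]

theorem l2_star (x : ι → ℂ) : l2 (star x) = l2 x :=
  l2_eq_of_sq (l2_nonneg x) (by simp [l2_sq])

theorem star_dotProduct_self (x : ι → ℂ) : star x ⬝ᵥ x = ((l2 x ^ 2 : ℝ) : ℂ) := by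
  rw [l2_sq]
  simp [dotProduct, ← Complex.conj_mul']

theorem norm_dotProduct_le (x y : ι → ℂ) : ‖star y ⬝ᵥ x‖ ≤ l2 x * l2 y := by
  have h := norm_inner_le_norm (𝕜 := ℂ) (WithLp.toLp 2 y) (WithLp.toLp 2 x)
  rw [EuclideanSpace.inner_toLp_toLp, dotProduct_comm] at h
  rw [mul_comm]
  exact h

theorem l2_tensor (x : ι → ℂ) (y : κ → ℂ) : l2 (fun p : ι × κ => x p.1 * y p.2) = l2 x * l2 y := by
  refine l2_eq_of_sq (mul_nonneg (l2_nonneg x) (l2_nonneg y)) ?_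
  rw [mul_pow, l2_sq, l2_sq, l2_sq, Fintype.sum_prod_type, Finset.sum_mul_sum]
  simp [mul_pow]

theorem l2_tensorPow (k : ℕ) (x : ι → ℂ) :
    l2 (fun p : Fin k → ι => ∏ l, x (p l)) = l2 x ^ k := by
  classical
  refine l2_eq_of_sq (pow_nonneg (l2_nonneg x) k) ?_
  rw [l2_sq, ← pow_mul, mul_comm k, pow_mul, l2_sq, ← Fin.prod_const, Finset.prod_univ_sum,
    Fintype.piFinset_univ]
  simp [Finset.prod_pow]

theorem ofReal_l2_conjTranspose_mulVec_sq (V : Matrix ι κ ℂ) (x : ι → ℂ) :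
    ((l2 (V.conjTranspose.mulVec x) ^ 2 : ℝ) : ℂ)
      = star x ⬝ᵥ (V * V.conjTranspose).mulVec x := by
  rw [← star_dotProduct_self, Matrix.star_mulVec, Matrix.conjTranspose_conjTranspose,
    ← Matrix.dotProduct_mulVec, Matrix.mulVec_mulVec]

variable [DecidableEq ι]

theorem l2_conjTranspose_mulVec {V : Matrix ι κ ℂ} (h : V * V.conjTranspose = 1) (x : ι → ℂ) :
    l2 (V.conjTranspose.mulVec x) = l2 x := by
  refine l2_eq_of_sq (l2_nonneg x) ?_
  have := ofReal_l2_conjTranspose_mulVec_sq V x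
  rw [h, Matrix.one_mulVec, star_dotProduct_self] at this
  exact_mod_cast this

theorem l2_sq_add_of_split {V : Matrix ι κ ℂ} {W : Matrix ι μ ℂ}
    (h : V * V.conjTranspose + W * W.conjTranspose = 1) (x : ι → ℂ) :
    l2 (V.conjTranspose.mulVec x) ^ 2 + l2 (W.conjTranspose.mulVec x) ^ 2 = l2 x ^ 2 := by
  have := star_dotProduct_self x
  nth_rw 2 [← Matrix.one_mulVec x] at this
  rw [← h, Matrix.add_mulVec, dotProduct_add, ← ofReal_l2_conjTranspose_mulVec_sq,
    ← ofReal_l2_conjTranspose_mulVec_sq] at this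
  exact_mod_cast this

/-- Cauchy–Schwarz in ℝ² for the pairs of component lengths of x and y. This is why cutting a
coefficient along an orthogonal splitting costs nothing in the gauge. -/
theorem l2_mul_add_of_split {V : Matrix ι κ ℂ} {W : Matrix ι μ ℂ}
    (h : V * V.conjTranspose + W * W.conjTranspose = 1) (x y : ι → ℂ) :
    l2 (V.conjTranspose.mulVec x) * l2 (V.conjTranspose.mulVec y)
      + l2 (W.conjTranspose.mulVec x) * l2 (W.conjTranspose.mulVec y) ≤ l2 x * l2 y := by
  have hx := l2_sq_add_of_split h x
  have hy := l2_sq_add_of_split h y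
  refine abs_le_of_sq_le_sq' ?_ (mul_nonneg (l2_nonneg x) (l2_nonneg y)) |>.2
  rw [mul_pow, ← hx, ← hy]
  nlinarith [sq_nonneg (l2 (V.conjTranspose.mulVec x) * l2 (W.conjTranspose.mulVec y)
    - l2 (W.conjTranspose.mulVec x) * l2 (V.conjTranspose.mulVec y))]

end EuclideanNorm

/-! ### Matrix coefficients and their behaviour under tensor products, conjugation and compression.
-/

section Coefficients

variable {G : Type*} [Group G] [TopologicalSpace G]
variable {ι κ μ : Type*} [Fintype ι] [Fintype κ] [Fintype μ]
variable [DecidableEq ι] [DecidableEq κ] [DecidableEq μ]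

/-- The matrix coefficient `s ↦ ⟨ρ(s) x, y⟩`. -/
noncomputable def coef (ρ : URep G ι) (x y : ι → ℂ) (s : G) : ℂ :=
  star y ⬝ᵥ (ρ s : Matrix ι ι ℂ).mulVec x

theorem URep.conjTranspose_mul (ρ : URep G ι) (s : G) :
    (ρ s : Matrix ι ι ℂ).conjTranspose * (ρ s : Matrix ι ι ℂ) = 1 :=
  Matrix.mem_unitaryGroup_iff'.mp (ρ s).2

theorem URep.mul_conjTranspose (ρ : URep G ι) (s : G) :
    (ρ s : Matrix ι ι ℂ) * (ρ s : Matrix ι ι ℂ).conjTranspose = 1 :=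
  Matrix.mem_unitaryGroup_iff.mp (ρ s).2

theorem URep.coe_inv (ρ : URep G ι) (s : G) :
    (ρ s⁻¹ : Matrix ι ι ℂ) = (ρ s : Matrix ι ι ℂ).conjTranspose := by
  rw [map_inv]
  rfl

theorem l2_URep_mulVec (ρ : URep G ι) (s : G) (x : ι → ℂ) :
    l2 ((ρ s : Matrix ι ι ℂ).mulVec x) = l2 x := by
  have := l2_conjTranspose_mulVec (V := (ρ s : Matrix ι ι ℂ).conjTranspose)
    (by rw [Matrix.conjTranspose_conjTranspose, ρ.conjTranspose_mul]) x
  rwa [Matrix.conjTranspose_conjTranspose] at this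

theorem norm_coef_le (ρ : URep G ι) (x y : ι → ℂ) (s : G) : ‖coef ρ x y s‖ ≤ l2 x * l2 y := by
  rw [← l2_URep_mulVec ρ s x]
  exact norm_dotProduct_le _ _

theorem continuous_coef (ρ : URep G ι) (x y : ι → ℂ) : Continuous (coef ρ x y) := by
  have h : Continuous fun s => (ρ s : Matrix ι ι ℂ) :=
    continuous_subtype_val.comp ρ.continuous_toFun
  exact continuous_const.dotProduct (h.matrix_mulVec continuous_const)

theorem coef_smul_left (ρ : URep G ι) (c : ℂ) (x y : ι → ℂ) (s : G) :
    coef ρ (c • x) y s = c * coef ρ x y s := by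
  simp [coef, Matrix.mulVec_smul]

theorem coef_single (ρ : URep G ι) (i j : ι) (s : G) :
    coef ρ (Pi.single j 1) (Pi.single i 1) s = (ρ s : Matrix ι ι ℂ) i j := by
  simp [coef]

theorem coef_mul_right (ρ : URep G ι) (x y : ι → ℂ) (s t : G) :
    coef ρ x y (s * t) = coef ρ ((ρ t : Matrix ι ι ℂ).mulVec x) y s := by
  simp [coef]

theorem coef_conj [IsTopologicalGroup G] (ρ : URep G ι) (x y : ι → ℂ) (s : G) :
    coef ρ.conj (star x) (star y) s = star (coef ρ x y s) := by
  have h : (ρ.conj s : Matrix ι ι ℂ) = (ρ s : Matrix ι ι ℂ).map star := by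
    change (ρ s⁻¹ : Matrix ι ι ℂ).transpose = _
    rw [ρ.coe_inv]
    rfl
  simp only [coef, h, dotProduct, Matrix.mulVec, star_sum, star_mul', Matrix.map_apply,
    Pi.star_apply]

theorem coef_tensor (ρ : URep G ι) (τ : URep G κ) (x y : ι → ℂ) (z w : κ → ℂ) (s : G) :
    coef (ρ.tensor τ) (fun p => x p.1 * z p.2) (fun p => y p.1 * w p.2) s
      = coef ρ x y s * coef τ z w s := by
  have h : (ρ.tensor τ s : Matrix (ι × κ) (ι × κ) ℂ)
    = (ρ s : Matrix ι ι ℂ) ⊗ₖ (τ s : Matrix κ κ ℂ) := rfl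
  simp only [coef, h, dotProduct, Matrix.mulVec, Fintype.sum_prod_type, Matrix.kroneckerMap_apply,
    Pi.star_apply, star_mul']
  rw [Finset.sum_mul_sum]
  refine Finset.sum_congr rfl fun i _ => Finset.sum_congr rfl fun j _ => ?_
  rw [mul_mul_mul_comm, Finset.sum_mul_sum]
  congr 1
  refine Finset.sum_congr rfl fun i _ => Finset.sum_congr rfl fun j _ => ?_
  ring

/-- Lets powers of a coefficient be estimated by the weight of ρ^{⊗k}; nonexponentiality enters only
through this identity. -/
theorem coef_tensorPow (ρ : URep G ι) (k : ℕ) (x y : ι → ℂ) (s : G) :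
    coef (ρ.tensorPow k) (fun p => ∏ l, x (p l)) (fun p => ∏ l, y (p l)) s
      = coef ρ x y s ^ k := by
  have h : (ρ.tensorPow k s : Matrix (Fin k → ι) (Fin k → ι) ℂ)
    = tensorPowMatrix k (ρ s : Matrix ι ι ℂ) := rfl
  simp only [coef, h, dotProduct, Matrix.mulVec, tensorPowMatrix, Matrix.of_apply, Pi.star_apply,
    star_prod, ← Finset.prod_mul_distrib]
  rw [← Fin.prod_const, Finset.prod_univ_sum, Fintype.piFinset_univ]
  refine Finset.sum_congr rfl fun i _ => ?_
  rw [Finset.prod_mul_distrib, Finset.prod_univ_sum, Fintype.piFinset_univ]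

/-- Coefficients of a subrepresentation. -/
theorem coef_of_intertwining {ρ : URep G ι} {σ : URep G κ} {V : Matrix ι κ ℂ}
    (h : ∀ s, (ρ s : Matrix ι ι ℂ) * V = V * (σ s : Matrix κ κ ℂ)) (x y : ι → ℂ) (s : G) :
    coef σ (V.conjTranspose.mulVec x) (V.conjTranspose.mulVec y) s
      = coef ρ ((V * V.conjTranspose).mulVec x) y s := by
  rw [coef, coef, Matrix.star_mulVec, Matrix.conjTranspose_conjTranspose,
    ← Matrix.dotProduct_mulVec, Matrix.mulVec_mulVec, Matrix.mulVec_mulVec, Matrix.mulVec_mulVec,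
    ← Matrix.mul_assoc, ← h]

theorem URep.Sub.trans {σ : URep G ι} {ρ : URep G κ} {τ : URep G μ} :
    URep.Sub σ ρ → URep.Sub ρ τ → URep.Sub σ τ := by
  rintro ⟨V, h1, h3⟩ ⟨W, k1, k3⟩
  refine ⟨W * V, ?_, fun s => ?_⟩
  · rw [Matrix.conjTranspose_mul, Matrix.mul_assoc, ← Matrix.mul_assoc W.conjTranspose, k1,
      Matrix.one_mul, h1]
  · rw [← Matrix.mul_assoc, k3, Matrix.mul_assoc, h3, Matrix.mul_assoc]

theorem URep.Equiv.sub {σ : URep G ι} {ρ : URep G κ} : URep.Equiv σ ρ → URep.Sub σ ρ :=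
  fun ⟨V, h1, _, h3⟩ => ⟨V, h1, h3⟩

/-- The compression of `ρ` to an invariant subspace, given by an isometry `V` onto it. -/
noncomputable def URep.compress (ρ : URep G ι) (V : Matrix ι κ ℂ) (hV : V.conjTranspose * V = 1)
    (h : ∀ s, V * (V.conjTranspose * ((ρ s : Matrix ι ι ℂ) * V)) = (ρ s : Matrix ι ι ℂ) * V) :
    URep G κ where
  toFun s := ⟨V.conjTranspose * ((ρ s : Matrix ι ι ℂ) * V), by
    rw [Matrix.mem_unitaryGroup_iff', Matrix.star_eq_conjTranspose]
    simp only [Matrix.conjTranspose_mul, Matrix.conjTranspose_conjTranspose, Matrix.mul_assoc, h]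
    rw [← Matrix.mul_assoc (Matrix.conjTranspose _) _ V, ρ.conjTranspose_mul, Matrix.one_mul, hV]⟩
  map_one' := by
    apply Subtype.ext
    simp [hV]
  map_mul' s t := by
    apply Subtype.ext
    simp only [map_mul, Matrix.UnitaryGroup.mul_val, Matrix.mul_assoc, h]
  continuous_toFun := by
    have h : Continuous fun s => (ρ s : Matrix ι ι ℂ) :=
      continuous_subtype_val.comp ρ.continuous_toFun
    exact Continuous.subtype_mk (continuous_const.matrix_mul (h.matrix_mul continuous_const)) _

theorem URep.compress_intertwining (ρ : URep G ι) (V : Matrix ι κ ℂ)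
    (hV : V.conjTranspose * V = 1)
    (h : ∀ s, V * (V.conjTranspose * ((ρ s : Matrix ι ι ℂ) * V)) = (ρ s : Matrix ι ι ℂ) * V)
    (s : G) :
    (ρ s : Matrix ι ι ℂ) * V = V * (ρ.compress V hV h s : Matrix κ κ ℂ) := (h s).symm

theorem URep.compress_sub (ρ : URep G ι) (V : Matrix ι κ ℂ) (hV : V.conjTranspose * V = 1)
    (h : ∀ s, V * (V.conjTranspose * ((ρ s : Matrix ι ι ℂ) * V)) = (ρ s : Matrix ι ι ℂ) * V) :
    URep.Sub (ρ.compress V hV h) ρ := ⟨V, hV, ρ.compress_intertwining V hV h⟩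

end Coefficients

/-! ### Orthogonal splitting of reducible representations. -/

section Splitting

variable {G : Type*} [Group G] [TopologicalSpace G]
variable {ι : Type*} [Fintype ι]

/-- The matrix whose columns are an orthonormal basis of the subspace `U`. -/
noncomputable def basisMatrix (U : Submodule ℂ (EuclideanSpace ℂ ι)) :
    Matrix ι (Fin (Module.finrank ℂ U)) ℂ :=
  Matrix.of fun i j => (stdOrthonormalBasis ℂ U j : EuclideanSpace ℂ ι) i

theorem basisMatrix_conjTranspose_mul (U : Submodule ℂ (EuclideanSpace ℂ ι)) :
    (basisMatrix U).conjTranspose * basisMatrix U = 1 := by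
  ext i j
  have h := orthonormal_iff_ite.mp (stdOrthonormalBasis ℂ U).orthonormal i j
  rw [Submodule.coe_inner, PiLp.inner_apply] at h
  simp only [RCLike.inner_apply] at h
  rw [Matrix.mul_apply, Matrix.one_apply, ← h]
  exact Finset.sum_congr rfl fun k _ => mul_comm _ _

theorem basisMatrix_mul_conjTranspose_mulVec (U : Submodule ℂ (EuclideanSpace ℂ ι))
    (x : EuclideanSpace ℂ ι) :
    WithLp.toLp 2 ((basisMatrix U * (basisMatrix U).conjTranspose).mulVec x.ofLp)
      = U.starProjection x := by
  ext i
  have h := congrArg (fun v : U => (v : EuclideanSpace ℂ ι) i)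
    ((stdOrthonormalBasis ℂ U).sum_repr' (U.orthogonalProjectionOnto x))
  simp only [Submodule.coe_sum, Submodule.coe_smul, WithLp.ofLp_sum, Finset.sum_apply,
    PiLp.smul_apply, smul_eq_mul] at h
  change _ = (U.orthogonalProjectionOnto x : EuclideanSpace ℂ ι) i
  rw [← h, ← Matrix.mulVec_mulVec]
  simp only [Matrix.mulVec, dotProduct]
  refine Finset.sum_congr rfl fun j _ => ?_
  rw [mul_comm, Submodule.inner_orthogonalProjectionOnto_eq_of_mem_left, PiLp.inner_apply]
  simp only [RCLike.inner_apply]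
  congr 1
  exact Finset.sum_congr rfl fun k _ => mul_comm _ _

theorem basisMatrix_invariant {U : Submodule ℂ (EuclideanSpace ℂ ι)} {M : Matrix ι ι ℂ}
    (h : ∀ x ∈ U, WithLp.toLp 2 (M.mulVec x.ofLp) ∈ U) :
    basisMatrix U * ((basisMatrix U).conjTranspose * (M * basisMatrix U)) = M * basisMatrix U := by
  refine Matrix.ext_of_mulVec_single fun j => ?_
  rw [← Matrix.mul_assoc, ← Matrix.mulVec_mulVec]
  apply WithLp.toLp_injective 2
  refine (basisMatrix_mul_conjTranspose_mulVec U
    (WithLp.toLp 2 ((M * basisMatrix U).mulVec (Pi.single j 1)))).trans ?_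
  refine Submodule.starProjection_eq_self_iff.mpr ?_
  rw [← Matrix.mulVec_mulVec]
  refine h (WithLp.toLp 2 ((basisMatrix U).mulVec (Pi.single j 1))) ?_
  have hj : WithLp.toLp 2 ((basisMatrix U).mulVec (Pi.single j 1))
      = (stdOrthonormalBasis ℂ U j : EuclideanSpace ℂ ι) := by
    ext i
    simp [basisMatrix]
  rw [hj]
  exact (stdOrthonormalBasis ℂ U j).2

variable [DecidableEq ι]

theorem basisMatrix_add_orthogonal (U : Submodule ℂ (EuclideanSpace ℂ ι)) :
    basisMatrix U * (basisMatrix U).conjTranspose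
      + basisMatrix Uᗮ * (basisMatrix Uᗮ).conjTranspose = 1 := by
  refine Matrix.ext_of_mulVec_single fun i => ?_
  apply WithLp.toLp_injective 2
  rw [Matrix.add_mulVec, WithLp.toLp_add]
  have h1 := basisMatrix_mul_conjTranspose_mulVec U (EuclideanSpace.single i 1)
  have h2 := basisMatrix_mul_conjTranspose_mulVec Uᗮ (EuclideanSpace.single i 1)
  rw [PiLp.ofLp_single] at h1 h2
  rw [h1, h2, U.starProjection_add_starProjection_orthogonal, Matrix.one_mulVec]
  rfl

/-- The adjoint of ρ(s) is ρ(s⁻¹), which preserves U. -/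
theorem URep.mem_orthogonal_of_invariant (ρ : URep G ι) {U : Submodule ℂ (EuclideanSpace ℂ ι)}
    (h : ∀ s, ∀ x ∈ U, WithLp.toLp 2 ((ρ s : Matrix ι ι ℂ).mulVec x.ofLp) ∈ U) (s : G)
    (x : EuclideanSpace ℂ ι) (hx : x ∈ Uᗮ) :
    WithLp.toLp 2 ((ρ s : Matrix ι ι ℂ).mulVec x.ofLp) ∈ Uᗮ := by
  intro y hy
  have := hx _ (h s⁻¹ y hy)
  rw [ρ.coe_inv, EuclideanSpace.inner_eq_star_dotProduct, Matrix.star_mulVec,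
    Matrix.conjTranspose_conjTranspose, dotProduct_comm, ← Matrix.dotProduct_mulVec] at this
  rw [EuclideanSpace.inner_eq_star_dotProduct, dotProduct_comm]
  exact this

/-- A reducible representation splits as an orthogonal sum of two proper subrepresentations. -/
theorem URep.exists_split {n : ℕ} (ρ : URep G (Fin n)) (hn : 0 < n)
    (hρ : ¬ ρ.toRepresentation.IsIrreducible) :
    ∃ (k l : ℕ) (σ : URep G (Fin k)) (τ : URep G (Fin l)) (V : Matrix (Fin n) (Fin k) ℂ)
      (W : Matrix (Fin n) (Fin l) ℂ), k < n ∧ l < n ∧ σ.Sub ρ ∧ τ.Sub ρ ∧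
      (∀ s, (ρ s : Matrix (Fin n) (Fin n) ℂ) * V = V * (σ s : Matrix (Fin k) (Fin k) ℂ)) ∧
      (∀ s, (ρ s : Matrix (Fin n) (Fin n) ℂ) * W = W * (τ s : Matrix (Fin l) (Fin l) ℂ)) ∧
      V * V.conjTranspose + W * W.conjTranspose = 1 := by
  obtain ⟨S, hS0, hS1⟩ : ∃ S : Subrepresentation ρ.toRepresentation, S ≠ ⊥ ∧ S ≠ ⊤ := by
    by_contra! hcon
    refine hρ ?_
    have : Nontrivial (Subrepresentation ρ.toRepresentation) := by
      refine ⟨⊥, ⊤, fun h => ?_⟩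
      have h2 : (Pi.single ⟨0, hn⟩ 1 : Fin n → ℂ) ∈
        (⊥ : Subrepresentation ρ.toRepresentation).toSubmodule := by
          rw [h]; exact Submodule.mem_top
      have h3 := congrFun ((Submodule.mem_bot ℂ).mp h2) ⟨0, hn⟩
      simp at h3
    exact { eq_bot_or_eq_top := fun a => or_iff_not_imp_left.mpr (hcon a) }
  let U : Submodule ℂ (EuclideanSpace ℂ (Fin n)) :=
    S.toSubmodule.comap (WithLp.linearEquiv 2 ℂ (Fin n → ℂ)).toLinearMap
  have hU : ∀ s, ∀ x ∈ U, WithLp.toLp 2 ((ρ s : Matrix (Fin n) (Fin n) ℂ).mulVec x.ofLp) ∈ U :=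
    fun s x hx => S.apply_mem_toSubmodule s hx
  have hUo := ρ.mem_orthogonal_of_invariant hU
  have hUtop : U ≠ ⊤ := fun h => hS1 <| by
    apply Subrepresentation.toSubmodule_injective
    refine Submodule.eq_top_iff'.mpr fun x => ?_
    have hx : WithLp.toLp 2 x ∈ U := h ▸ Submodule.mem_top
    exact hx
  have hUbot : U ≠ ⊥ := fun h => hS0 <| by
    apply Subrepresentation.toSubmodule_injective
    refine (Submodule.eq_bot_iff _).mpr fun x hx => ?_
    have hx : WithLp.toLp 2 x ∈ U := hx
    rw [h, Submodule.mem_bot] at hx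
    exact congrArg WithLp.ofLp hx
  have hcard : Module.finrank ℂ (EuclideanSpace ℂ (Fin n)) = n := finrank_euclideanSpace_fin
  have hsum := U.finrank_add_finrank_orthogonal
  have h1 : Module.finrank ℂ U < n := (Submodule.finrank_lt hUtop).trans_eq hcard
  have h2 : 0 < Module.finrank ℂ U := by
    rw [Nat.pos_iff_ne_zero]
    exact fun h => hUbot (Submodule.finrank_eq_zero.mp h)
  exact ⟨_, _, _, _, basisMatrix U, basisMatrix Uᗮ, h1, by omega,
    ρ.compress_sub _ (basisMatrix_conjTranspose_mul _) fun s => basisMatrix_invariant (hU s),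
    ρ.compress_sub _ (basisMatrix_conjTranspose_mul _) fun s => basisMatrix_invariant (hUo s),
    ρ.compress_intertwining _ _ _, ρ.compress_intertwining _ _ _, basisMatrix_add_orthogonal U⟩

/-- The class in `Ĝ` of an irreducible representation is represented by an equivalent one. -/
theorem exists_dual_equiv {n : ℕ} (ρ : URep G (Fin n)) (h : ρ.toRepresentation.IsIrreducible) :
    ∃ π : Dual G, π.rep.Equiv ρ :=
  ⟨Quotient.mk _ ⟨n, ρ, h⟩, Quotient.mk_out (s := irrepSetoid G) (⟨n, ρ, h⟩ : Irrep G)⟩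

/-- Every representation on `ℂ^ι` is equivalent to one on some `ℂ^n`. -/
theorem URep.exists_equiv_fin (ρ : URep G ι) : ∃ σ : URep G (Fin (Fintype.card ι)), σ.Equiv ρ := by
  let e := Fintype.equivFin ι
  let V : Matrix ι (Fin (Fintype.card ι)) ℂ := (1 : Matrix ι ι ℂ).submatrix id e.symm
  have hV : V.conjTranspose = (1 : Matrix ι ι ℂ).submatrix e.symm id := by
    simp [V, Matrix.conjTranspose_submatrix]
  have h1 : V.conjTranspose * V = 1 := by
    rw [hV, ← Matrix.submatrix_mul (1 : Matrix ι ι ℂ) 1 e.symm id e.symm Function.bijective_id]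
    simp
  have h2 : V * V.conjTranspose = 1 := by
    rw [hV, ← Matrix.submatrix_mul (1 : Matrix ι ι ℂ) 1 id e.symm id e.symm.bijective]
    simp
  have h3 : ∀ s, V * (V.conjTranspose * ((ρ s : Matrix ι ι ℂ) * V)) = (ρ s : Matrix ι ι ℂ) * V := by
    intro s
    rw [← Matrix.mul_assoc, h2, Matrix.one_mul]
  exact ⟨ρ.compress V h1 h3, V, h1, h2, ρ.compress_intertwining V h1 h3⟩

end Splitting

/-! ### Trivial and conjugate representations; symmetric weights are at least 1. -/

section Irreducible

variable {G : Type*} [Group G] [TopologicalSpace G]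
variable {ι κ μ ν : Type*} [Fintype ι] [Fintype κ] [Fintype μ] [Fintype ν]
variable [DecidableEq ι] [DecidableEq κ] [DecidableEq μ] [DecidableEq ν]

theorem Dual.irreducible (π : Dual G) : π.rep.toRepresentation.IsIrreducible :=
  (Quotient.out π).irreducible

theorem URep.dim_pos {n : ℕ} {ρ : URep G (Fin n)} (h : ρ.toRepresentation.IsIrreducible) :
    0 < n := by
  rw [Nat.pos_iff_ne_zero]
  rintro rfl
  obtain ⟨a, b, hab⟩ := h.toNontrivial
  exact hab (Subrepresentation.toSubmodule_injective (Subsingleton.elim _ _))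

/-- Half of Schur's lemma: the range of V is invariant and has dimension at most k < n, so it is
zero. Multiplicativity of σ plays no role, so that σ may be the entrywise conjugate of a
representation. -/
theorem URep.eq_zero_of_intertwining {n k : ℕ} {ρ : URep G (Fin n)}
    (h : ρ.toRepresentation.IsIrreducible) {σ : G → Matrix (Fin k) (Fin k) ℂ}
    {V : Matrix (Fin n) (Fin k) ℂ} (hk : k < n)
    (hV : ∀ s, (ρ s : Matrix (Fin n) (Fin n) ℂ) * V = V * σ s) : V = 0 := by
  let S : Subrepresentation ρ.toRepresentation :=
    { toSubmodule := LinearMap.range V.mulVecLin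
      apply_mem_toSubmodule := by
        rintro s _ ⟨x, rfl⟩
        refine ⟨(σ s).mulVec x, ?_⟩
        change V.mulVec _ = (ρ s : Matrix (Fin n) (Fin n) ℂ).mulVec (V.mulVec x)
        rw [Matrix.mulVec_mulVec, Matrix.mulVec_mulVec, hV] }
  rcases h.eq_bot_or_eq_top S with hS | hS
  · have h2 : LinearMap.range V.mulVecLin = ⊥ := congrArg Subrepresentation.toSubmodule hS
    rw [LinearMap.range_eq_bot] at h2
    exact Matrix.ext_of_mulVec_single fun i => by
      rw [← Matrix.mulVecLin_apply, h2, LinearMap.zero_apply, Matrix.zero_mulVec]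
  · have h2 : LinearMap.range V.mulVecLin = ⊤ := congrArg Subrepresentation.toSubmodule hS
    have h3 := LinearMap.finrank_range_le V.mulVecLin
    rw [h2, finrank_top] at h3
    simp only [Module.finrank_fin_fun] at h3
    omega

/-- The trivial representation. -/
noncomputable def URep.triv (G : Type*) [Group G] [TopologicalSpace G] : URep G (Fin 1) where
  toFun _ := 1
  map_one' := rfl
  map_mul' _ _ := (one_mul 1).symm
  continuous_toFun := continuous_const

theorem URep.triv_irreducible : (URep.triv G).toRepresentation.IsIrreducible := by
  by_contra h
  obtain ⟨k, l, -, -, V, W, hk, hl, -, -, -, -, hVW⟩ := (URep.triv G).exists_split one_pos h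
  have h0 := congrFun (congrFun hVW 0) 0
  obtain rfl : k = 0 := by omega
  obtain rfl : l = 0 := by omega
  simp at h0

theorem coef_triv (s : G) : coef (URep.triv G) (Pi.single 0 1) (Pi.single 0 1) s = 1 := by
  rw [coef_single]
  rfl

theorem URep.conj_apply [IsTopologicalGroup G] (ρ : URep G ι) (s : G) :
    (ρ.conj s : Matrix ι ι ℂ) = (ρ s : Matrix ι ι ℂ).map (starRingEnd ℂ) := by
  change (ρ s⁻¹ : Matrix ι ι ℂ).transpose = _
  rw [ρ.coe_inv]
  rfl

theorem URep.intertwining_of_conj [IsTopologicalGroup G] {ρ : URep G ι} {σ : URep G κ}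
    {V : Matrix ι κ ℂ}
    (h : ∀ s, (ρ.conj s : Matrix ι ι ℂ) * V = V * (σ s : Matrix κ κ ℂ)) (s : G) :
    (ρ s : Matrix ι ι ℂ) * V.map (starRingEnd ℂ)
      = V.map (starRingEnd ℂ) * (σ s : Matrix κ κ ℂ).map (starRingEnd ℂ) := by
  rw [← Matrix.map_mul, ← h, Matrix.map_mul, ρ.conj_apply]
  congr 1
  ext
  simp

/-- The inclusions V, W of a splitting of the conjugate become, after entrywise conjugation,
intertwiners from smaller spaces into ρ. They vanish, against VV* + WW* = 1. -/
theorem URep.conj_irreducible [IsTopologicalGroup G] {n : ℕ} {ρ : URep G (Fin n)}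
    (hρ : ρ.toRepresentation.IsIrreducible) : ρ.conj.toRepresentation.IsIrreducible := by
  by_contra h
  have hn := URep.dim_pos hρ
  obtain ⟨k, l, σ, τ, V, W, hk, hl, -, -, hV, hW, hVW⟩ := ρ.conj.exists_split hn h
  have map_eq_zero : ∀ {m : ℕ} {V : Matrix (Fin n) (Fin m) ℂ}, V.map (starRingEnd ℂ) = 0 → V = 0 :=
    fun {m V} h => by
      ext i j
      simpa using congrFun (congrFun h i) j
  have h1 := map_eq_zero (URep.eq_zero_of_intertwining hρ hk (URep.intertwining_of_conj hV))
  have h2 := map_eq_zero (URep.eq_zero_of_intertwining hρ hl (URep.intertwining_of_conj hW))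
  have h3 := congrFun (congrFun hVW ⟨0, hn⟩) ⟨0, hn⟩
  simp [h1, h2] at h3

theorem URep.Sub.tensor {σ : URep G ι} {ρ : URep G κ} {σ' : URep G μ} {ρ' : URep G ν} :
    URep.Sub σ ρ → URep.Sub σ' ρ' → URep.Sub (σ.tensor σ') (ρ.tensor ρ') := by
  rintro ⟨V, h1, h2⟩ ⟨W, k1, k2⟩
  refine ⟨V ⊗ₖ W, ?_, fun s => ?_⟩
  · rw [Matrix.conjTranspose_kronecker, ← Matrix.mul_kronecker_mul, h1, k1, Matrix.one_kronecker_one]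
  · change (_ ⊗ₖ _) * _ = _ * (_ ⊗ₖ _)
    rw [← Matrix.mul_kronecker_mul, h2, k2, Matrix.mul_kronecker_mul]

theorem URep.sub_triv_tensor (ρ : URep G ι) : URep.Sub ρ ((URep.triv G).tensor ρ) := by
  refine ⟨Matrix.of fun p j => if p.2 = j then 1 else 0, ?_, fun s => ?_⟩
  · ext i j
    rw [Matrix.mul_apply, Fintype.sum_prod_type]
    simp only [Matrix.conjTranspose_apply, Matrix.of_apply, Matrix.one_apply, Fin.sum_univ_one]
    rw [Finset.sum_eq_single i (fun b _ hb => by simp [hb]) (by simp)]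
    simp
  · have h : ((URep.triv G).tensor ρ s : Matrix (Fin 1 × ι) (Fin 1 × ι) ℂ)
      = ((URep.triv G s : Matrix (Fin 1) (Fin 1) ℂ) ⊗ₖ (ρ s : Matrix ι ι ℂ)) := rfl
    have h1 : (URep.triv G s : Matrix (Fin 1) (Fin 1) ℂ) = 1 := rfl
    rw [h, h1]
    ext ⟨a, i⟩ j
    simp [Matrix.mul_apply, Fintype.sum_prod_type, Matrix.one_apply, Subsingleton.elim a 0]

/-- The unit vector d^{-1/2} ∑ eᵢ ⊗ eᵢ is invariant, because ρ(s)ρ(s)* = 1. -/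
theorem URep.triv_sub_tensor_conj [IsTopologicalGroup G] [Nonempty ι] (ρ : URep G ι) :
    URep.Sub (URep.triv G) (ρ.tensor ρ.conj) := by
  have hd : (Fintype.card ι : ℝ) ≠ 0 := Nat.cast_ne_zero.mpr Fintype.card_ne_zero
  have hc : (((√(Fintype.card ι : ℝ))⁻¹ : ℝ) : ℂ) * (((√(Fintype.card ι : ℝ))⁻¹ : ℝ) : ℂ)
      = (Fintype.card ι : ℂ)⁻¹ := by
    rw [← Complex.ofReal_mul, ← mul_inv, Real.mul_self_sqrt (Nat.cast_nonneg _)]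
    simp
  refine ⟨Matrix.of fun p _ => if p.1 = p.2 then (((√(Fintype.card ι : ℝ))⁻¹ : ℝ) : ℂ) else 0,
    ?_, fun s => ?_⟩
  · ext a b
    have hd' : (Fintype.card ι : ℂ) ≠ 0 := by exact_mod_cast hd
    simp only [Matrix.mul_apply, Fintype.sum_prod_type, Matrix.conjTranspose_apply, Matrix.of_apply,
      apply_ite star, star_zero, mul_ite, mul_zero, ite_mul, zero_mul, RCLike.star_def,
      Complex.conj_ofReal, hc]
    simp [Matrix.one_apply, Subsingleton.elim a b, hd']
  · change (_ ⊗ₖ (ρ.conj s : Matrix ι ι ℂ)) * _ = _ * (1 : Matrix (Fin 1) (Fin 1) ℂ)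
    rw [Matrix.mul_one, ρ.conj_apply]
    ext ⟨i, j⟩ a
    have h := congrFun (congrFun (ρ.mul_conjTranspose s) i) j
    simp only [Matrix.mul_apply, Matrix.conjTranspose_apply, Matrix.one_apply] at h
    simp only [Matrix.mul_apply, Fintype.sum_prod_type, Matrix.kroneckerMap_apply, Matrix.map_apply,
      Matrix.of_apply, mul_ite, mul_zero, Finset.sum_ite_eq, Finset.mem_univ, if_true,
      ← Finset.sum_mul, starRingEnd_apply, h, ite_mul, one_mul, zero_mul]

variable {ω : Dual G → ℝ}

theorem exists_dual_triv : ∃ τ : Dual G, τ.rep.Equiv (URep.triv G) :=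
  exists_dual_equiv _ URep.triv_irreducible

theorem exists_dual_conj [IsTopologicalGroup G] (π : Dual G) :
    ∃ σ : Dual G, σ.rep.Equiv π.rep.conj :=
  exists_dual_equiv _ (URep.conj_irreducible π.irreducible)

/-- A symmetric weight is at least `1`. -/
theorem IsWeight.one_le [IsTopologicalGroup G] (hω : IsWeight ω) (hsymm : IsSymmetricWeight ω)
    (π : Dual G) : 1 ≤ ω π := by
  obtain ⟨τ, hτ⟩ := exists_dual_triv (G := G)
  obtain ⟨σ, hσ⟩ := exists_dual_conj π
  have h1 : ω π ≤ ω τ * ω π :=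
    hω.2 π τ π ((URep.sub_triv_tensor π.rep).trans (hτ.symm.sub.tensor (URep.Equiv.refl _).sub))
  have : Nonempty (Fin π.dim) := ⟨⟨0, URep.dim_pos π.irreducible⟩⟩
  have h2 : ω τ ≤ ω π * ω σ :=
    hω.2 τ π σ (hτ.sub.trans ((URep.triv_sub_tensor_conj π.rep).trans
      ((URep.Equiv.refl _).sub.tensor hσ.symm.sub)))
  rw [hsymm π σ hσ] at h2
  have := hω.1 π
  -- `h1` gives ω(τ) ≥ 1 for the trivial class τ, and `h2` now reads ω(τ) ≤ ω(π)².
  nlinarith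

end Irreducible

/-! ### The gauge: sums, products, conjugates, translates and Neumann series. -/

section NormLE

variable {G : Type u} [Group G] [TopologicalSpace G]
variable {ι κ : Type*} [Fintype ι] [Fintype κ] [DecidableEq ι] [DecidableEq κ]

/-- `NormLE ω u C` says that `u` is an absolutely convergent sum of matrix coefficients
`s ↦ ⟨π(s) x, y⟩` of irreducible representations, with `∑ ‖x‖ ‖y‖ ω(π) ≤ C`. -/
def NormLE (ω : Dual G → ℝ) (u : G → ℂ) (C : ℝ) : Prop :=
  ∃ (I : Type u) (π : I → Dual G) (x y : ∀ i, Fin (π i).dim → ℂ) (S : ℝ), S ≤ C ∧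
    HasSum (fun i => l2 (x i) * l2 (y i) * ω (π i)) S ∧
    ∀ s, HasSum (fun i => coef (π i).rep (x i) (y i) s) (u s)

variable {ω : Dual G → ℝ} {u v : G → ℂ} {C D : ℝ}

theorem NormLE.mono (h : NormLE ω u C) (hCD : C ≤ D) : NormLE ω u D := by
  obtain ⟨I, π, x, y, S, hS, h1, h2⟩ := h
  exact ⟨I, π, x, y, S, hS.trans hCD, h1, h2⟩

theorem NormLE.of_dual (π : Dual G) (x y : Fin π.dim → ℂ) :
    NormLE ω (coef π.rep x y) (l2 x * l2 y * ω π) :=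
  ⟨PUnit, fun _ => π, fun _ => x, fun _ => y, _, le_rfl,
    by simp, fun s => by simp⟩

theorem NormLE.zero : NormLE ω 0 0 :=
  ⟨PEmpty, PEmpty.elim, fun i => i.elim, fun i => i.elim, 0, le_rfl, hasSum_empty,
    fun _ => hasSum_empty⟩

theorem NormLE.const_mul (h : NormLE ω u C) (c : ℂ) : NormLE ω (fun s => c * u s) (‖c‖ * C) := by
  obtain ⟨I, π, x, y, S, hS, h1, h2⟩ := h
  refine ⟨I, π, fun i => c • x i, y, ‖c‖ * S, mul_le_mul_of_nonneg_left hS (norm_nonneg c), ?_, ?_⟩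
  · simpa only [l2_smul, mul_assoc] using h1.mul_left ‖c‖
  · intro s
    simpa only [coef_smul_left] using (h2 s).mul_left c

theorem NormLE.of_equiv {π : Dual G} {ρ : URep G ι} (h : π.rep.Equiv ρ) (x y : ι → ℂ) :
    NormLE ω (coef ρ x y) (l2 x * l2 y * ω π) := by
  obtain ⟨V, -, h2, h3⟩ := h
  have := NormLE.of_dual (ω := ω) π (V.conjTranspose.mulVec x) (V.conjTranspose.mulVec y)
  rw [l2_conjTranspose_mulVec h2, l2_conjTranspose_mulVec h2] at this
  convert this using 1
  funext s
  rw [coef_of_intertwining h3, h2, Matrix.one_mulVec]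

section OneLe

variable (hω : ∀ π, 1 ≤ ω π)
include hω

theorem nonneg_term (π : Dual G) (x y : Fin π.dim → ℂ) : 0 ≤ l2 x * l2 y * ω π :=
  mul_nonneg (mul_nonneg (l2_nonneg x) (l2_nonneg y)) (zero_le_one.trans (hω π))

theorem norm_coef_le_term (π : Dual G) (x y : Fin π.dim → ℂ) (s : G) :
    ‖coef π.rep x y s‖ ≤ l2 x * l2 y * ω π :=
  (norm_coef_le π.rep x y s).trans
    (le_mul_of_one_le_right (mul_nonneg (l2_nonneg x) (l2_nonneg y)) (hω π))

theorem NormLE.nonneg (h : NormLE ω u C) : 0 ≤ C := by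
  obtain ⟨I, π, x, y, S, hS, h1, -⟩ := h
  exact (h1.nonneg fun i => nonneg_term hω _ _ _).trans hS

theorem NormLE.norm_le (h : NormLE ω u C) (s : G) : ‖u s‖ ≤ C := by
  obtain ⟨I, π, x, y, S, hS, h1, h2⟩ := h
  exact ((h2 s).norm_le_of_bounded h1 fun i => norm_coef_le_term hω _ _ _ s).trans hS

theorem NormLE.continuous (h : NormLE ω u C) : Continuous u := by
  obtain ⟨I, π, x, y, S, hS, h1, h2⟩ := h
  have : u = fun s => ∑' i, coef (π i).rep (x i) (y i) s :=
    funext fun s => (h2 s).tsum_eq.symm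
  rw [this]
  exact continuous_tsum (fun i => continuous_coef _ _ _) h1.summable
    fun i s => norm_coef_le_term hω _ _ _ s

/-- The expansions are concatenated over a sigma type. Since ω ≥ 1, the costs dominate the
coefficients pointwise, so summability of the costs justifies the rearrangement. -/
theorem NormLE.hasSum {J : Type u} {f : J → G → ℂ} {c : J → ℝ} (h : ∀ j, NormLE ω (f j) (c j))
    (hc : HasSum c C) (hf : ∀ s, HasSum (fun j => f j s) (u s)) : NormLE ω u C := by
  choose I π x y S hS h1 h2 using h
  have hS0 : ∀ j, 0 ≤ S j := fun j => (h1 j).nonneg fun i => nonneg_term hω _ _ _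
  have hSsum : Summable S := hc.summable.of_nonneg_of_le hS0 hS
  have hsum : HasSum (fun p : Σ j, I j => l2 (x p.1 p.2) * l2 (y p.1 p.2) * ω (π p.1 p.2))
      (∑' j, S j) := by
    refine HasSum.sigma_of_hasSum hSsum.hasSum h1 ?_
    rw [summable_sigma_of_nonneg fun p => nonneg_term hω _ _ _]
    exact ⟨fun j => (h1 j).summable, by simpa only [(h1 _).tsum_eq] using hSsum⟩
  refine ⟨Σ j, I j, fun p => π p.1 p.2, fun p => x p.1 p.2, fun p => y p.1 p.2, ∑' j, S j,
    hasSum_le hS hSsum.hasSum hc, hsum, fun s => ?_⟩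
  exact HasSum.sigma_of_hasSum (hf s) (fun j => h2 j s)
    (Summable.of_norm_bounded hsum.summable fun p => norm_coef_le_term hω _ _ _ s)

/-- Index types in `NormLE` live in the universe of G; this version admits `Bool`, `ℕ` and `Fin n`.
-/
theorem NormLE.hasSum_ulift {J : Type} {f : J → G → ℂ} {c : J → ℝ} (h : ∀ j, NormLE ω (f j) (c j))
    (hc : HasSum c C) (hf : ∀ s, HasSum (fun j => f j s) (u s)) : NormLE ω u C :=
  NormLE.hasSum hω (J := ULift.{u} J) (f := fun j => f j.down) (fun j => h j.down)
    (Equiv.ulift.hasSum_iff.mpr hc) fun s => (Equiv.ulift.hasSum_iff (f := fun j => f j s)).mpr (hf s)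

theorem NormLE.add (hu : NormLE ω u C) (hv : NormLE ω v D) :
    NormLE ω (fun s => u s + v s) (C + D) := by
  refine NormLE.hasSum_ulift hω (J := Bool) (f := fun b => cond b u v) (c := fun b => cond b C D)
    (by rintro (_ | _) <;> assumption) ?_ fun s => ?_
  · simpa using hasSum_fintype (fun b => cond b C D)
  · simpa using hasSum_fintype (fun b => cond b u v s)

/-- Coefficients of an arbitrary finite-dimensional representation. -/
theorem NormLE.of_uRep_fin (n : ℕ) : ∀ (ρ : URep G (Fin n)) (_ : 0 ≤ D)
    (_ : ∀ σ : Dual G, σ.rep.Sub ρ → ω σ ≤ D) (x y : Fin n → ℂ),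
    NormLE ω (coef ρ x y) (l2 x * l2 y * D) := by
  induction n using Nat.strong_induction_on with
  | _ n ih =>
    intro ρ hD h x y
    by_cases hρ : ρ.toRepresentation.IsIrreducible
    · obtain ⟨π, hπ⟩ := exists_dual_equiv ρ hρ
      exact (NormLE.of_equiv hπ x y).mono
        (mul_le_mul_of_nonneg_left (h π hπ.sub) (mul_nonneg (l2_nonneg x) (l2_nonneg y)))
    · rcases Nat.eq_zero_or_pos n with rfl | hn
      · have h0 : coef ρ x y = 0 := by
          funext s
          simp [coef]
        rw [h0]
        exact NormLE.zero.mono (mul_nonneg (mul_nonneg (l2_nonneg x) (l2_nonneg y)) hD)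
      · obtain ⟨k, l, σ, τ, V, W, hk, hl, hσ, hτ, hV, hW, hVW⟩ := ρ.exists_split hn hρ
        have h1 := ih k hk σ hD (fun π hπ => h π (hπ.trans hσ)) (V.conjTranspose.mulVec x)
          (V.conjTranspose.mulVec y)
        have h2 := ih l hl τ hD (fun π hπ => h π (hπ.trans hτ)) (W.conjTranspose.mulVec x)
          (W.conjTranspose.mulVec y)
        -- The two pieces together cost no more than the whole, so the bound survives the induction
        -- without a dimension factor.
        have h3 := (NormLE.add hω h1 h2).mono (D := l2 x * l2 y * D) (by
          rw [← add_mul]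
          exact mul_le_mul_of_nonneg_right (l2_mul_add_of_split hVW x y) hD)
        convert h3 using 1
        funext s
        rw [coef_of_intertwining hV, coef_of_intertwining hW, coef,
          coef, coef, ← dotProduct_add, ← Matrix.mulVec_add,
          ← Matrix.add_mulVec, hVW, Matrix.one_mulVec]

theorem NormLE.of_uRep (ρ : URep G ι) (hD : 0 ≤ D) (h : ∀ σ : Dual G, σ.rep.Sub ρ → ω σ ≤ D)
    (x y : ι → ℂ) : NormLE ω (coef ρ x y) (l2 x * l2 y * D) := by
  obtain ⟨σ, hσ⟩ := ρ.exists_equiv_fin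
  obtain ⟨V, -, h2, h3⟩ := id hσ
  have := NormLE.of_uRep_fin hω _ σ hD (fun π hπ => h π (hπ.trans hσ.sub))
    (V.conjTranspose.mulVec x) (V.conjTranspose.mulVec y)
  rw [l2_conjTranspose_mulVec h2, l2_conjTranspose_mulVec h2] at this
  convert this using 1
  funext s
  rw [coef_of_intertwining h3, h2, Matrix.one_mulVec]

/-- Each product of two terms is a coefficient of π ⊗ σ, all of whose constituents have weight at
most ω(π)ω(σ). -/
theorem NormLE.mul (hw : IsWeight ω) (hu : NormLE ω u C) (hv : NormLE ω v D) :
    NormLE ω (fun s => u s * v s) (C * D) := by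
  have hD := hv.nonneg hω
  obtain ⟨I, π, x, y, S, hS, h1, h2⟩ := hu
  obtain ⟨J, σ, z, w, T, hT, k1, k2⟩ := hv
  have hS0 : 0 ≤ S := h1.nonneg fun i => nonneg_term hω _ _ _
  have h1n : Summable fun i => ‖l2 (x i) * l2 (y i) * ω (π i)‖ := h1.summable.norm
  have k1n : Summable fun i => ‖l2 (z i) * l2 (w i) * ω (σ i)‖ := k1.summable.norm
  refine NormLE.mono (C := S * T) ?_ (mul_le_mul hS hT (k1.nonneg fun i => nonneg_term hω _ _ _)
    (hS0.trans hS))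
  refine NormLE.hasSum hω (J := I × J)
    (f := fun p s => coef (π p.1).rep (x p.1) (y p.1) s
      * coef (σ p.2).rep (z p.2) (w p.2) s)
    (fun p => ?_) (h1.mul k1 (summable_mul_of_summable_norm h1n k1n)) fun s => ?_
  · have := NormLE.of_uRep hω ((π p.1).rep.tensor (σ p.2).rep)
      (mul_nonneg (zero_le_one.trans (hω _)) (zero_le_one.trans (hω _)))
      (fun τ hτ => hw.2 τ _ _ hτ) (fun q => x p.1 q.1 * z p.2 q.2) (fun q => y p.1 q.1 * w p.2 q.2)
    rw [l2_tensor, l2_tensor] at this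
    convert this using 1
    · funext s
      rw [coef_tensor]
    · ring
  · have h3 : Summable fun i => ‖coef (π i).rep (x i) (y i) s‖ :=
      h1.summable.of_nonneg_of_le (fun _ => norm_nonneg _) fun i => norm_coef_le_term hω _ _ _ s
    have k3 : Summable fun j => ‖coef (σ j).rep (z j) (w j) s‖ :=
      k1.summable.of_nonneg_of_le (fun _ => norm_nonneg _) fun i => norm_coef_le_term hω _ _ _ s
    have h4 := summable_mul_of_summable_norm h3 k3
    exact HasSum.mul (f := fun i => coef (π i).rep (x i) (y i) s)
      (g := fun j => coef (σ j).rep (z j) (w j) s) (h2 s) (k2 s) h4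

theorem NormLE.pow_succ (hw : IsWeight ω) (hu : NormLE ω u C) (n : ℕ) :
    NormLE ω (fun s => u s ^ (n + 1)) (C ^ (n + 1)) := by
  induction n with
  | zero => simpa using hu
  | succ n ih => simpa only [_root_.pow_succ _ (n + 1)] using ih.mul hω hw hu

theorem NormLE.star [IsTopologicalGroup G] (hsymm : IsSymmetricWeight ω) (hu : NormLE ω u C) :
    NormLE ω (fun s => star (u s)) C := by
  obtain ⟨I, π, x, y, S, hS, h1, h2⟩ := hu
  refine NormLE.mono ?_ hS
  refine NormLE.hasSum hω (fun i => ?_) h1 fun s => (h2 s).star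
  obtain ⟨σ, hσ⟩ := exists_dual_conj (π i)
  have := NormLE.of_equiv (ω := ω) hσ (Star.star (x i)) (Star.star (y i))
  rw [l2_star, l2_star, hsymm _ _ hσ] at this
  convert this using 1
  exact funext fun s => (coef_conj _ _ _ s).symm

omit hω in
theorem NormLE.translate (hu : NormLE ω u C) (t : G) : NormLE ω (fun s => u (s * t)) C := by
  obtain ⟨I, π, x, y, S, hS, h1, h2⟩ := hu
  refine ⟨I, π, fun i => ((π i).rep t : Matrix _ _ ℂ).mulVec (x i), y, S, hS, ?_, fun s => ?_⟩
  · simpa only [l2_URep_mulVec] using h1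
  · simpa only [coef_mul_right] using h2 (s * t)

omit hω in
theorem exists_normLE_one (ω : Dual G → ℝ) : ∃ C, NormLE ω (fun _ => 1) C := by
  obtain ⟨τ, hτ⟩ := exists_dual_triv (G := G)
  have := NormLE.of_equiv (ω := ω) hτ (Pi.single 0 1) (Pi.single 0 1)
  exact ⟨_, by simpa only [funext coef_triv] using this⟩

/-- The Neumann series of `u`. -/
theorem NormLE.exists_neumann (hw : IsWeight ω) (hu : NormLE ω u C) (hC : C < 1) :
    ∃ v D, NormLE ω v D ∧ ∀ s, v s = u s + u s * v s := by
  have hC0 := hu.nonneg hω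
  have hlt : ∀ s, ‖u s‖ < 1 := fun s => (hu.norm_le hω s).trans_lt hC
  -- The series ∑ uⁿ⁺¹ starts at the first power: the constant 1 is not needed, and its gauge bound
  -- would involve ω of the trivial class.
  refine ⟨fun s => u s * (1 - u s)⁻¹, C * (1 - C)⁻¹,
    NormLE.hasSum_ulift hω (J := ℕ) (fun n => hu.pow_succ hω hw n) ?_ fun s => ?_, fun s => ?_⟩
  · simpa only [_root_.pow_succ'] using (hasSum_geometric_of_lt_one hC0 hC).mul_left C
  · simpa only [_root_.pow_succ'] using (hasSum_geometric_of_norm_lt_one (hlt s)).mul_left (u s)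
  · have : 1 - u s ≠ 0 := fun h => by
      have := hlt s
      rw [← sub_eq_zero.mp h, norm_one] at this
      exact lt_irrefl _ this
    field_simp
    ring

end OneLe

end NormLE

/-! ### The trace norm and rank-one decompositions. -/

section TraceNorm

variable {n : ℕ}

theorem traceNorm_nonneg (A : Matrix (Fin n) (Fin n) ℂ) : 0 ≤ traceNorm A :=
  Finset.sum_nonneg fun _ _ => LinearMap.singularValues_nonneg _ _

/-- Right singular vectors. -/
theorem exists_orthonormalBasis_singularValues (A : Matrix (Fin n) (Fin n) ℂ) :
    ∃ b : OrthonormalBasis (Fin n) ℂ (EuclideanSpace ℂ (Fin n)), ∀ i j,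
      inner ℂ (Matrix.toEuclideanLin A (b i)) (Matrix.toEuclideanLin A (b j))
        = if i = j then (((Matrix.toEuclideanLin A).singularValues i : ℝ) : ℂ) ^ 2 else 0 := by
  have hn : Module.finrank ℂ (EuclideanSpace ℂ (Fin n)) = n := finrank_euclideanSpace_fin
  set T := Matrix.toEuclideanLin A
  refine ⟨T.isSymmetric_adjoint_comp_self.eigenvectorBasis hn, fun i j => ?_⟩
  rw [← LinearMap.adjoint_inner_right, ← LinearMap.comp_apply,
    T.isSymmetric_adjoint_comp_self.apply_eigenvectorBasis hn, inner_smul_right,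
    OrthonormalBasis.inner_eq_ite, ← T.sq_singularValues_fin hn]
  split_ifs with h
  · subst h
    simp
  · simp

theorem sum_singularValues_eq_traceNorm (A : Matrix (Fin n) (Fin n) ℂ) :
    ∑ i : Fin n, (Matrix.toEuclideanLin A).singularValues i = traceNorm A :=
  Fin.sum_univ_eq_sum_range (fun i => (Matrix.toEuclideanLin A).singularValues i) n

/-- Singular value decomposition: A = ∑ (A bᵢ) bᵢ* for a basis of right singular vectors, and ‖A bᵢ‖
is the i-th singular value. -/
theorem exists_eq_sum_vecMulVec (A : Matrix (Fin n) (Fin n) ℂ) :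
    ∃ x y : Fin n → Fin n → ℂ, (A = ∑ i, Matrix.vecMulVec (x i) (star (y i))) ∧
      ∑ i, l2 (x i) * l2 (y i) = traceNorm A := by
  obtain ⟨b, hb⟩ := exists_orthonormalBasis_singularValues A
  refine ⟨fun i => A.mulVec (b i).ofLp, fun i => (b i).ofLp, ?_, ?_⟩
  · refine Matrix.ext_of_mulVec_single fun j => ?_
    have h := congrArg (fun v => A.mulVec v.ofLp) (b.sum_repr' (EuclideanSpace.single j 1))
    simp only [WithLp.ofLp_sum, WithLp.ofLp_smul, Matrix.mulVec_sum, Matrix.mulVec_smul] at h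
    rw [Matrix.sum_mulVec]
    refine h.symm.trans (Finset.sum_congr rfl fun i _ => ?_)
    ext k
    simp [Matrix.vecMulVec_apply, mul_comm, EuclideanSpace.inner_single_right]
  · rw [← sum_singularValues_eq_traceNorm]
    refine Finset.sum_congr rfl fun i _ => ?_
    have h1 : l2 (b i).ofLp = 1 := b.orthonormal.1 i
    rw [h1, mul_one]
    refine l2_eq_of_sq (LinearMap.singularValues_nonneg _ _) ?_
    have h2 := hb i i
    rw [if_pos rfl, inner_self_eq_norm_sq_to_K] at h2
    change ‖Matrix.toEuclideanLin A (b i)‖ ^ 2 = _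
    refine Complex.ofReal_injective ?_
    push_cast
    exact h2

/-- With singular vectors bᵢ and vᵢ = σᵢ⁻¹ A bᵢ, the trace norm is ∑ ⟨vᵢ, A bᵢ⟩ over σᵢ ≠ 0.
Expanding A, the j-th term ∑ᵢ ⟨vᵢ, xⱼ⟩⟨yⱼ, bᵢ⟩ is at most ‖xⱼ‖‖yⱼ‖ by Cauchy–Schwarz and Bessel for
both orthonormal families. -/
theorem traceNorm_le_of_hasSum {J : Type*} {x y : J → Fin n → ℂ} {S : ℝ}
    {A : Matrix (Fin n) (Fin n) ℂ} (hS : HasSum (fun j => l2 (x j) * l2 (y j)) S)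
    (hA : ∀ a b, HasSum (fun j => x j a * star (y j b)) (A a b)) : traceNorm A ≤ S := by
  classical
  obtain ⟨b, hb⟩ := exists_orthonormalBasis_singularValues A
  set σ : Fin n → ℝ := fun i => (Matrix.toEuclideanLin A).singularValues i with hσ
  let v : {i // σ i ≠ 0} → EuclideanSpace ℂ (Fin n) :=
    fun i => ((σ i : ℂ)⁻¹) • Matrix.toEuclideanLin A (b i)
  have hv : Orthonormal ℂ v := by
    rw [orthonormal_iff_ite]
    intro i j
    have hi : (σ i : ℂ) ≠ 0 := by exact_mod_cast i.2
    rw [inner_smul_left, inner_smul_right, hb]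
    by_cases h : i = j
    · subst h
      rw [if_pos rfl, if_pos rfl, map_inv₀, Complex.conj_ofReal]
      change (σ i : ℂ)⁻¹ * ((σ i : ℂ)⁻¹ * (σ i : ℂ) ^ 2) = 1
      field_simp
    · rw [if_neg h, if_neg fun h' => h (Subtype.ext h'), mul_zero, mul_zero]
  have hb' : Orthonormal ℂ fun i : {i // σ i ≠ 0} => b i :=
    b.orthonormal.comp _ Subtype.val_injective
  have hval : ∀ i : {i // σ i ≠ 0}, inner ℂ (v i) (Matrix.toEuclideanLin A (b i)) = (σ i : ℂ) := by
    intro i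
    have hi : (σ i : ℂ) ≠ 0 := by exact_mod_cast i.2
    rw [inner_smul_left, hb, if_pos rfl, map_inv₀, Complex.conj_ofReal]
    change (σ i : ℂ)⁻¹ * (σ i : ℂ) ^ 2 = _
    field_simp
  have hsum : HasSum (fun j => ∑ i : {i // σ i ≠ 0}, inner ℂ (v i) (WithLp.toLp 2 (x j))
      * inner ℂ (WithLp.toLp 2 (y j)) (b i)) (∑ i : {i // σ i ≠ 0}, (σ i : ℂ)) := by
    refine hasSum_sum fun i _ => ?_
    have h := hasSum_sum (s := Finset.univ) fun a _ => hasSum_sum (s := Finset.univ) fun c _ =>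
      ((hA a c).mul_left (star ((v i).ofLp a))).mul_right ((b i).ofLp c)
    have e1 : (fun j => inner ℂ (v i) (WithLp.toLp 2 (x j)) * inner ℂ (WithLp.toLp 2 (y j)) (b i))
        = fun j => ∑ a, ∑ c, star ((v i).ofLp a) * (x j a * star (y j c)) * (b i).ofLp c := by
      funext j
      simp only [PiLp.inner_apply, RCLike.inner_apply, Finset.sum_mul_sum]
      refine Finset.sum_congr rfl fun a _ => Finset.sum_congr rfl fun c _ => ?_
      simp only [starRingEnd_apply]
      ring
    have e2 : (σ i : ℂ) = ∑ a, ∑ c, star ((v i).ofLp a) * A a c * (b i).ofLp c := by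
      rw [← hval, PiLp.inner_apply]
      refine Finset.sum_congr rfl fun a _ => ?_
      simp only [RCLike.inner_apply, starRingEnd_apply, Matrix.toLpLin_apply, Matrix.mulVec,
        dotProduct, Finset.sum_mul]
      exact Finset.sum_congr rfl fun c _ => by ring
    rw [e1, e2]
    exact h
  have hle : ‖∑ i : {i // σ i ≠ 0}, (σ i : ℂ)‖ ≤ S := by
    refine hsum.norm_le_of_bounded hS fun j => ?_
    refine (norm_sum_le _ _).trans ?_
    simp only [norm_mul]
    refine (Real.sum_mul_le_sqrt_mul_sqrt _ _ _).trans ?_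
    refine mul_le_mul ?_ ?_ (Real.sqrt_nonneg _) (l2_nonneg _)
    · exact Real.sqrt_le_iff.mpr ⟨l2_nonneg _, hv.sum_inner_products_le _⟩
    · refine Real.sqrt_le_iff.mpr ⟨l2_nonneg _, ?_⟩
      simp only [norm_inner_symm (WithLp.toLp 2 (y j))]
      exact hb'.sum_inner_products_le _
  rw [← sum_singularValues_eq_traceNorm, ← Finset.sum_filter_ne_zero]
  have h2 : ∑ i : {i // σ i ≠ 0}, σ i = ∑ i with σ i ≠ 0, σ i :=
    (Finset.sum_subtype _ (by simp) _).symm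
  rw [← h2]
  rw [← Complex.ofReal_sum, Complex.norm_real] at hle
  exact (le_abs_self _).trans hle

end TraceNorm

/-! ### The gauge describes the Beurling–Fourier algebra. -/

section FunctionAlgebra

variable {G : Type u} [Group G] [TopologicalSpace G] {ω : Dual G → ℝ}

theorem trace_vecMulVec_mul {n : ℕ} (x y : Fin n → ℂ) (M : Matrix (Fin n) (Fin n) ℂ) :
    (Matrix.vecMulVec x (star y) * M).trace = star y ⬝ᵥ M.mulVec x := by
  rw [Matrix.vecMulVec_mul, Matrix.trace_vecMulVec, dotProduct_comm, ← Matrix.dotProduct_mulVec]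

theorem norm_apply_le_l2 {n : ℕ} (x : Fin n → ℂ) (i : Fin n) : ‖x i‖ ≤ l2 x :=
  PiLp.norm_apply_le (WithLp.toLp 2 x) i

theorem NormLE.of_trace (hω : ∀ π, 1 ≤ ω π) (π : Dual G) (A : Matrix (Fin π.dim) (Fin π.dim) ℂ) :
    NormLE ω (fun s => (π.dim : ℂ) * (A * (π.rep s : Matrix _ _ ℂ)).trace)
      (traceNorm A * π.dim * ω π) := by
  obtain ⟨x, y, hA, hn⟩ := exists_eq_sum_vecMulVec A
  refine NormLE.hasSum_ulift hω (J := Fin π.dim)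
    (fun i => NormLE.of_dual π ((π.dim : ℂ) • x i) (y i)) ?_ fun s => ?_
  · convert hasSum_fintype _ using 1
    simp only [← hn, l2_smul, Complex.norm_natCast, Finset.sum_mul]
    exact Finset.sum_congr rfl fun i _ => by ring
  · convert hasSum_fintype _ using 1
    simp only [coef_smul_left]
    rw [← Finset.mul_sum]
    nth_rw 1 [hA]
    rw [Finset.sum_mul, Matrix.trace_sum]
    exact congrArg _ (Finset.sum_congr rfl fun i _ => trace_vecMulVec_mul _ _ _)

/-- Terms with the same class p are gathered into one operator d_p⁻¹ ∑ xⱼ yⱼ*, whose trace norm is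
at most the sum of the rank-one costs. The families `X`, `Y` are x, y transported along π i = p. -/
theorem mem_beurlingFourierSet_of_normLE (hω : ∀ π, 1 ≤ ω π) {u : C(G, ℂ)} {C : ℝ}
    (h : NormLE ω u C) : u ∈ beurlingFourierSet ω := by
  obtain ⟨I, π, x, y, S, -, h1, h2⟩ := h
  let X : ∀ p, {i // π i = p} → Fin p.dim → ℂ := fun p j => j.2 ▸ x j.1
  let Y : ∀ p, {i // π i = p} → Fin p.dim → ℂ := fun p j => j.2 ▸ y j.1
  have e1 : HasSum (fun q : Σ p, {i // π i = p} => l2 (X q.1 q.2) * l2 (Y q.1 q.2) * ω q.1) S := by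
    rw [← (Equiv.sigmaFiberEquiv π).hasSum_iff] at h1
    convert h1 using 1
    funext ⟨p, i, hi⟩
    subst hi
    rfl
  have e2 : ∀ s, HasSum (fun q : Σ p, {i // π i = p} => coef q.1.rep (X q.1 q.2) (Y q.1 q.2) s)
      (u s) := by
    intro s
    have h3 := h2 s
    rw [← (Equiv.sigmaFiberEquiv π).hasSum_iff] at h3
    convert h3 using 1
    funext ⟨p, i, hi⟩
    subst hi
    rfl
  have hω0 : ∀ p, ω p ≠ 0 := fun p => (zero_lt_one.trans_le (hω p)).ne'
  have f1 : ∀ p, Summable fun j => l2 (X p j) * l2 (Y p j) := fun p =>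
    (summable_mul_right_iff (hω0 p)).mp (e1.summable.sigma_factor p)
  have f2 : ∀ p a b, Summable fun j => X p j a * star (Y p j b) := fun p a b => by
    refine Summable.of_norm_bounded (f1 p) fun j => ?_
    rw [norm_mul, norm_star]
    exact mul_le_mul (norm_apply_le_l2 _ _) (norm_apply_le_l2 _ _) (norm_nonneg _) (l2_nonneg _)
  have hd : ∀ p : Dual G, (p.dim : ℂ) ≠ 0 := fun p =>
    Nat.cast_ne_zero.mpr (URep.dim_pos p.irreducible).ne'
  have hdr : ∀ p : Dual G, (p.dim : ℝ) ≠ 0 := fun p =>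
    Nat.cast_ne_zero.mpr (URep.dim_pos p.irreducible).ne'
  let f : ∀ p : Dual G, Matrix (Fin p.dim) (Fin p.dim) ℂ := fun p =>
    Matrix.of fun a b => (p.dim : ℂ)⁻¹ * ∑' j, X p j a * star (Y p j b)
  have hf : ∀ p, traceNorm (f p) ≤ (p.dim : ℝ)⁻¹ * ∑' j, l2 (X p j) * l2 (Y p j) := by
    intro p
    refine traceNorm_le_of_hasSum (x := fun j => (p.dim : ℂ)⁻¹ • X p j) (y := Y p) ?_ fun a b => ?_
    · simpa only [l2_smul, norm_inv, Complex.norm_natCast, mul_assoc] using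
        (f1 p).hasSum.mul_left (p.dim : ℝ)⁻¹
    · have h := (f2 p a b).hasSum.mul_left (p.dim : ℂ)⁻¹
      simp only [Pi.smul_apply, smul_eq_mul, mul_assoc]
      exact h
  refine ⟨f, ?_, fun s => ?_⟩
  · refine Summable.of_nonneg_of_le (fun p => mul_nonneg (mul_nonneg (traceNorm_nonneg _)
      (Nat.cast_nonneg _)) (zero_le_one.trans (hω p))) (fun p => ?_) e1.summable.sigma
    change _ ≤ ∑' j, l2 (X p j) * l2 (Y p j) * ω p
    rw [tsum_mul_right]
    refine mul_le_mul_of_nonneg_right ?_ (zero_le_one.trans (hω p))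
    calc traceNorm (f p) * p.dim
        ≤ ((p.dim : ℝ)⁻¹ * ∑' j, l2 (X p j) * l2 (Y p j)) * p.dim :=
          mul_le_mul_of_nonneg_right (hf p) (Nat.cast_nonneg _)
      _ = ∑' j, l2 (X p j) * l2 (Y p j) := by
          have := hdr p
          field_simp
  · refine (e2 s).sigma fun p => ?_
    have h := hasSum_sum (s := Finset.univ) fun a _ => hasSum_sum (s := Finset.univ) fun b _ =>
      (f2 p a b).hasSum.mul_right ((p.rep s : Matrix _ _ ℂ) b a)
    have k1 : (fun j => coef p.rep (X p j) (Y p j) s)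
        = fun j => ∑ a, ∑ b, X p j a * star (Y p j b) * (p.rep s : Matrix _ _ ℂ) b a := by
      funext j
      simp only [coef, dotProduct, Matrix.mulVec, Finset.mul_sum]
      rw [Finset.sum_comm]
      refine Finset.sum_congr rfl fun a _ => Finset.sum_congr rfl fun b _ => ?_
      simp only [Pi.star_apply]
      ring
    have k2 : (p.dim : ℂ) * (f p * (p.rep s : Matrix _ _ ℂ)).trace
        = ∑ a, ∑ b, (∑' j, X p j a * star (Y p j b)) * (p.rep s : Matrix _ _ ℂ) b a := by
      simp only [Matrix.trace, Matrix.diag, Matrix.mul_apply, f, Matrix.of_apply, Finset.mul_sum]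
      refine Finset.sum_congr rfl fun a _ => Finset.sum_congr rfl fun b _ => ?_
      rw [← mul_assoc, ← mul_assoc, mul_inv_cancel₀ (hd p), one_mul]
    rw [k2]
    change HasSum (fun j => coef p.rep (X p j) (Y p j) s) _
    rw [k1]
    exact h

theorem mem_beurlingFourierSet_iff (hω : ∀ π, 1 ≤ ω π) (u : C(G, ℂ)) :
    u ∈ beurlingFourierSet ω ↔ ∃ C, NormLE ω u C := by
  refine ⟨?_, fun ⟨C, h⟩ => mem_beurlingFourierSet_of_normLE hω h⟩
  rintro ⟨f, hf, hu⟩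
  exact ⟨_, NormLE.hasSum hω (fun π => NormLE.of_trace hω π (f π)) hf.hasSum hu⟩

/-- The Beurling–Fourier algebra. -/
noncomputable def beurlingFourierAlgebra (ω : Dual G → ℝ) (hw : IsWeight ω) (hω : ∀ π, 1 ≤ ω π) :
    Subalgebra ℂ C(G, ℂ) where
  carrier := {u | ∃ C, NormLE ω u C}
  mul_mem' := fun ⟨_, hu⟩ ⟨_, hv⟩ => ⟨_, hu.mul hω hw hv⟩
  add_mem' := fun ⟨_, hu⟩ ⟨_, hv⟩ => ⟨_, hu.add hω hv⟩
  algebraMap_mem' c := by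
    obtain ⟨C, hC⟩ := exists_normLE_one ω
    have := hC.const_mul c
    simp only [mul_one] at this
    exact ⟨_, this⟩

end FunctionAlgebra

/-! ### Finite-dimensional representations separate points. -/

section PeterWeyl

open MeasureTheory

variable {G : Type u} [Group G]
variable {H : Type*} [NormedAddCommGroup H] [InnerProductSpace ℂ H]

theorem unitary_mul_apply (U : G →* (H ≃ₗᵢ[ℂ] H)) (s t : G) (v : H) :
    U (s * t) v = U s (U t v) := by
  rw [map_mul]
  rfl

theorem unitary_one_apply (U : G →* (H ≃ₗᵢ[ℂ] H)) (v : H) : U 1 v = v := by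
  rw [map_one]
  rfl

theorem unitary_inner_right (U : G →* (H ≃ₗᵢ[ℂ] H)) (s : G) (v w : H) :
    inner ℂ v (U s w) = inner ℂ (U s⁻¹ v) w := by
  rw [← LinearIsometryEquiv.inner_map_map (U s⁻¹), ← unitary_mul_apply, inv_mul_cancel,
    unitary_one_apply]

variable [TopologicalSpace G]

/-- The matrix representation on a finite-dimensional invariant subspace, in an orthonormal
basis. -/
noncomputable def uRepOfInvariant (U : G →* (H ≃ₗᵢ[ℂ] H)) (hU : ∀ v, Continuous fun s => U s v)
    (E : Submodule ℂ H) [FiniteDimensional ℂ E] (hE : ∀ s, ∀ v ∈ E, U s v ∈ E) :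
    URep G (Fin (Module.finrank ℂ E)) := by
  let b := stdOrthonormalBasis ℂ E
  have key : ∀ s t i j, ∑ k, inner ℂ (b i : H) (U s (b k)) * inner ℂ (b k : H) (U t (b j))
      = inner ℂ (b i : H) (U (s * t) (b j)) := by
    intro s t i j
    have h2 := b.sum_inner_mul_inner ⟨U s⁻¹ (b i), hE _ _ (b i).2⟩ ⟨U t (b j), hE _ _ (b j).2⟩
    simp only [Submodule.coe_inner] at h2
    rw [unitary_mul_apply, unitary_inner_right, ← h2]
    exact Finset.sum_congr rfl fun k _ => by rw [unitary_inner_right]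
  have one : ∀ i j, inner ℂ (b i : H) (U 1 (b j)) = if i = j then 1 else 0 := fun i j => by
    rw [unitary_one_apply]
    exact orthonormal_iff_ite.mp b.orthonormal i j
  let M : G → Matrix (Fin (Module.finrank ℂ E)) (Fin (Module.finrank ℂ E)) ℂ :=
    fun s => Matrix.of fun i j => inner ℂ (b i : H) (U s (b j))
  have hmul : ∀ s t, M (s * t) = M s * M t := fun s t => by
    ext i j
    exact (key s t i j).symm
  have hone : M 1 = 1 := by
    ext i j
    rw [Matrix.one_apply]
    exact one i j
  have hstar : ∀ s, star (M s) = M s⁻¹ := fun s => by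
    ext i j
    change star (inner ℂ (b j : H) (U s (b i))) = inner ℂ (b i : H) (U s⁻¹ (b j))
    rw [← starRingEnd_apply, inner_conj_symm, unitary_inner_right, inv_inv]
  have hmem : ∀ s, M s ∈ Matrix.unitaryGroup (Fin (Module.finrank ℂ E)) ℂ := fun s => by
    rw [Matrix.mem_unitaryGroup_iff, hstar, ← hmul, mul_inv_cancel, hone]
  exact
    { toFun := fun s => ⟨M s, hmem s⟩
      map_one' := Subtype.ext hone
      map_mul' := fun s t => Subtype.ext (hmul s t)
      continuous_toFun := Continuous.subtype_mk
        (continuous_matrix fun i j => continuous_const.inner (hU _)) hmem }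

theorem uRepOfInvariant_apply (U : G →* (H ≃ₗᵢ[ℂ] H)) (hU : ∀ v, Continuous fun s => U s v)
    (E : Submodule ℂ H) [FiniteDimensional ℂ E] (hE : ∀ s, ∀ v ∈ E, U s v ∈ E) (s : G)
    (i j : Fin (Module.finrank ℂ E)) :
    (uRepOfInvariant U hU E hE s : Matrix _ _ ℂ) i j
      = inner ℂ (stdOrthonormalBasis ℂ E i : H) (U s (stdOrthonormalBasis ℂ E j)) := rfl

theorem uRepOfInvariant_ne_one (U : G →* (H ≃ₗᵢ[ℂ] H)) (hU : ∀ v, Continuous fun s => U s v)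
    (E : Submodule ℂ H) [FiniteDimensional ℂ E] (hE : ∀ s, ∀ v ∈ E, U s v ∈ E) {s : G} {v : H}
    (hv : v ∈ E) (hsv : U s v ≠ v) : uRepOfInvariant U hU E hE s ≠ 1 := by
  intro h
  apply hsv
  set b := stdOrthonormalBasis ℂ E with hb
  have h1 : ∀ j, U s (b j) = b j := by
    intro j
    have h2 := b.sum_repr' ⟨U s (b j), hE _ _ (b j).2⟩
    have h3 : ∀ i, inner ℂ (b i) (⟨U s (b j), hE _ _ (b j).2⟩ : E)
        = (1 : Matrix (Fin (Module.finrank ℂ E)) (Fin (Module.finrank ℂ E)) ℂ) i j := fun i => by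
      rw [Submodule.coe_inner, hb, ← uRepOfInvariant_apply U hU E hE, h]
      rfl
    simp only [h3, Matrix.one_apply, ite_smul, one_smul, zero_smul, Finset.sum_ite_eq',
      Finset.mem_univ, if_true] at h2
    exact (congrArg Subtype.val h2).symm
  have h4 := congrArg Subtype.val (b.sum_repr' ⟨v, hv⟩)
  simp only [Submodule.coe_sum, Submodule.coe_smul] at h4
  rw [← h4, map_sum]
  exact Finset.sum_congr rfl fun i _ => by rw [map_smul, h1]

variable [IsTopologicalGroup G] [CompactSpace G] [MeasurableSpace G] [BorelSpace G]

theorem integrable_of_continuous {X : Type*} [TopologicalSpace X] [CompactSpace X]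
    [MeasurableSpace X] [BorelSpace X] (μ : Measure X) [IsFiniteMeasure μ] {E : Type*}
    [NormedAddCommGroup E] {f : X → E} (hf : Continuous f) : Integrable f μ :=
  hf.integrable_of_hasCompactSupport (HasCompactSupport.of_compactSpace f)

variable [CompleteSpace H]

/-- If `s` acts non-trivially in a strongly continuous unitary representation of a compact group,
then it acts non-trivially in a finite-dimensional one. -/
theorem exists_uRep_ne_one_of_unitary (μ : Measure G) [IsProbabilityMeasure μ]
    [μ.IsMulLeftInvariant] [μ.IsOpenPosMeasure] (U : G →* (H ≃ₗᵢ[ℂ] H))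
    (hU : ∀ v, Continuous fun s => U s v) {s₀ : G} {k : H} (hk : U s₀ k ≠ k) :
    ∃ (n : ℕ) (ρ : URep G (Fin n)), ρ s₀ ≠ 1 := by
  let F : G → H →L[ℂ] H := fun y => InnerProductSpace.rankOne ℂ (U y k) (U y k)
  have hF : Continuous F := by
    have h1 : Continuous fun y => ContinuousLinearMap.smulRightL ℂ H H (innerSL ℂ (U y k)) :=
      (ContinuousLinearMap.smulRightL ℂ H H).continuous.comp ((innerSL ℂ).continuous.comp (hU k))
    exact h1.clm_apply (hU k)
  have hFi : Integrable F μ := integrable_of_continuous μ hF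
  -- Averaging the rank-one operator of k over its orbit gives a compact self-adjoint operator
  -- commuting with U. Its eigenspaces for nonzero eigenvalues are finite-dimensional and invariant.
  let S : H →L[ℂ] H := ∫ y, F y ∂μ
  have hS : ∀ v, S v = ∫ y, inner ℂ (U y k) v • U y k ∂μ := fun v =>
    ContinuousLinearMap.integral_apply hFi v
  have hint : ∀ v, Integrable (fun y => inner ℂ (U y k) v • U y k) μ := fun v =>
    integrable_of_continuous μ (((hU k).inner continuous_const).smul (hU k))
  have hinner : ∀ v w, inner ℂ w (S v) = ∫ y, inner ℂ (U y k) v * inner ℂ w (U y k) ∂μ := by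
    intro v w
    rw [hS, ← integral_inner (hint v)]
    simp only [inner_smul_right]
  have hsymm : S.IsSymmetric := by
    intro v w
    change inner ℂ (S v) w = inner ℂ v (S w)
    rw [← inner_conj_symm, hinner, hinner, ← integral_conj]
    refine integral_congr_ae (Eventually.of_forall fun y => ?_)
    simp only [map_mul, inner_conj_symm]
    exact mul_comm _ _
  -- The compact operators form a closed convex set, which contains the average of operators in it.
  have hcompact : IsCompactOperator S := by
    have hmem : S ∈ compactOperator (RingHom.id ℂ) H H := by
      have hconv : Convex ℝ (compactOperator (RingHom.id ℂ) H H : Set (H →L[ℂ] H)) :=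
        ((compactOperator (RingHom.id ℂ) H H).restrictScalars ℝ).convex
      refine hconv.integral_mem ?_ (Eventually.of_forall fun y => ?_) hFi
      · exact isClosed_setOfPred_isCompactOperator
      · change IsCompactOperator (F y)
        have h1 := isCompactOperator_of_locallyCompactSpace_dom (innerSL ℂ (U y k) : H →L[ℂ] ℂ)
        exact h1.clm_comp (ContinuousLinearMap.toSpanSingleton ℂ (U y k))
    exact hmem
  have hcomm : ∀ s v, U s (S v) = S (U s v) := by
    intro s v
    rw [hS, hS, ← integral_mul_left_eq_self (fun y => inner ℂ (U y k) (U s v) • U y k) s]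
    refine
      ((U s).toContinuousLinearEquiv.toContinuousLinearMap.integral_comp_comm (hint v)).symm.trans
      ?_
    refine integral_congr_ae (Eventually.of_forall fun y => ?_)
    change U s (inner ℂ (U y k) v • U y k) = inner ℂ (U (s * y) k) (U s v) • U (s * y) k
    rw [map_smul, unitary_mul_apply, LinearIsometryEquiv.inner_map_map]
  -- ⟨v, Sv⟩ is the integral of |⟨v, U(y)k⟩|², a continuous function, and nonempty open sets have
  -- positive measure.
  have hker : ∀ v, S v = 0 → ∀ y, inner ℂ v (U y k) = 0 := by
    intro v hv
    have h1 := hinner v v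
    rw [hv, inner_zero_right] at h1
    have hc : Continuous fun y => ‖inner ℂ v (U y k)‖ ^ 2 := (continuous_const.inner (hU k)).norm.pow 2
    have h2 : ∫ y, ‖inner ℂ v (U y k)‖ ^ 2 ∂μ = 0 := by
      rw [← Complex.ofReal_inj, ← integral_complex_ofReal, Complex.ofReal_zero, h1]
      refine integral_congr_ae (Eventually.of_forall fun y => ?_)
      change ((‖inner ℂ v (U y k)‖ ^ 2 : ℝ) : ℂ) = inner ℂ (U y k) v * inner ℂ v (U y k)
      rw [← inner_conj_symm, Complex.mul_conj', RCLike.norm_conj]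
      push_cast
      rfl
    rw [integral_eq_zero_iff_of_nonneg (fun y => by positivity) (integrable_of_continuous μ hc)] at h2
    have h3 := (hc.ae_eq_iff_eq μ continuous_const).mp h2
    intro y
    exact norm_eq_zero.mp (pow_eq_zero_iff two_ne_zero |>.mp (congrFun h3 y))
  -- Otherwise U(s₀)k − k is orthogonal to every eigenspace of S, hence 0: on the kernel by `hker`,
  -- and elsewhere because s₀ fixes the finite-dimensional eigenspace.
  by_contra! hcon
  apply hk
  rw [← sub_eq_zero, ← Submodule.mem_bot ℂ,
    ← ContinuousLinearMap.orthogonalComplement_iSup_eigenspaces_eq_bot hcompact hsymm]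
  rw [← Submodule.iInf_orthogonal, Submodule.mem_iInf]
  intro c v hv
  rw [Module.End.mem_eigenspace_iff] at hv
  change S v = c • v at hv
  rw [inner_sub_right, sub_eq_zero]
  rcases eq_or_ne c 0 with rfl | hc
  · rw [zero_smul] at hv
    have h1 := hker v hv 1
    rw [unitary_one_apply] at h1
    rw [hker v hv, h1]
  · let E := Module.End.eigenspace (S : H →ₗ[ℂ] H) c
    have hfin : FiniteDimensional ℂ E :=
      ContinuousLinearMap.finite_dimensional_eigenspace hcompact c hc
    have hE : ∀ s, ∀ w ∈ E, U s w ∈ E := fun s w hw => by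
      rw [Module.End.mem_eigenspace_iff] at hw ⊢
      change S w = c • w at hw
      change S (U s w) = c • U s w
      rw [← hcomm, hw, map_smul]
    have hvE : v ∈ E := Module.End.mem_eigenspace_iff.mpr hv
    have hfix : U s₀ v = v := by
      by_contra hne
      exact uRepOfInvariant_ne_one U hU E hE hvE hne (hcon _ _)
    rw [← LinearIsometryEquiv.inner_map_map (U s₀) v k, hfix]

/-- Translation `f ↦ f(s⁻¹ ·)` on `L²(G)`. -/
noncomputable def leftTranslation (μ : Measure G) [μ.IsMulLeftInvariant] :
    G →* (Lp ℂ 2 μ ≃ₗᵢ[ℂ] Lp ℂ 2 μ) where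
  toFun s :=
    { toFun := fun f => DomMulAct.mk s⁻¹ • f
      invFun := fun f => DomMulAct.mk s • f
      map_add' := DomMulAct.smul_Lp_add _
      map_smul' := fun c f => smul_comm _ c f
      left_inv := fun f => by
        change DomMulAct.mk s • DomMulAct.mk s⁻¹ • f = f
        rw [← mul_smul, ← DomMulAct.mk_mul, inv_mul_cancel, DomMulAct.mk_one, one_smul]
      right_inv := fun f => by
        change DomMulAct.mk s⁻¹ • DomMulAct.mk s • f = f
        rw [← mul_smul, ← DomMulAct.mk_mul, mul_inv_cancel, DomMulAct.mk_one, one_smul]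
      norm_map' := fun f => DomMulAct.norm_smul_Lp _ f }
  map_one' := LinearIsometryEquiv.ext fun f => by
    change DomMulAct.mk (1 : G)⁻¹ • f = f
    rw [inv_one, DomMulAct.mk_one, one_smul]
  map_mul' s t := LinearIsometryEquiv.ext fun f => by
    change DomMulAct.mk (s * t)⁻¹ • f = DomMulAct.mk s⁻¹ • DomMulAct.mk t⁻¹ • f
    rw [← mul_smul, ← DomMulAct.mk_mul, mul_inv_rev]

/-- Normalized Haar measure. -/
theorem exists_haar_isProbabilityMeasure : ∃ μ : Measure G,
    IsProbabilityMeasure μ ∧ μ.IsMulLeftInvariant ∧ μ.IsOpenPosMeasure ∧ μ.Regular :=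
  ⟨Measure.haarMeasure ⊤, ⟨Measure.haarMeasure_self (K₀ := ⊤)⟩, inferInstance, inferInstance,
    inferInstance⟩

/-- The finite-dimensional unitary representations of a compact group separate its points. -/
theorem exists_uRep_ne_one {G : Type u} [Group G] [TopologicalSpace G] [IsTopologicalGroup G]
    [CompactSpace G] [T2Space G] {s₀ : G} (hs : s₀ ≠ 1) :
    ∃ (n : ℕ) (ρ : URep G (Fin n)), ρ s₀ ≠ 1 := by
  borelize G
  obtain ⟨μ, _, _, _, _⟩ := exists_haar_isProbabilityMeasure (G := G)
  have : Fact ((2 : ENNReal) ≠ ⊤) := ⟨by simp⟩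
  -- The translate f(s₀⁻¹ ·) and f differ at the point 1, hence differ in L², both being continuous.
  obtain ⟨f, hf0, hf1, -⟩ := exists_continuous_zero_one_of_isClosed (X := G)
    (isClosed_singleton (x := s₀⁻¹)) (isClosed_singleton (x := 1))
    (by simpa [eq_comm] using hs)
  have hfc : Continuous fun x => (f x : ℂ) := Complex.continuous_ofReal.comp f.continuous
  have hmem : ∀ {g : G → ℂ}, Continuous g → MemLp g 2 μ := fun hg =>
    hg.memLp_of_hasCompactSupport (HasCompactSupport.of_compactSpace _)
  refine exists_uRep_ne_one_of_unitary μ (leftTranslation μ) (fun v => ?_) (s₀ := s₀)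
    (k := (hmem hfc).toLp _) fun h => ?_
  · have h1 : Continuous fun s : G => DomMulAct.mk s⁻¹ :=
      DomMulAct.continuous_mk.comp continuous_inv
    exact h1.smul continuous_const
  · change DomMulAct.mk s₀⁻¹ • (hmem hfc).toLp _ = (hmem hfc).toLp _ at h
    rw [DomMulAct.mk_smul_toLp, MemLp.toLp_eq_toLp_iff] at h
    have h2 := congrFun ((Continuous.ae_eq_iff_eq μ (hfc.comp (continuous_const_smul s₀⁻¹))
      hfc).mp h) 1
    simp only [Function.comp_apply, smul_eq_mul, mul_one] at h2
    rw [hf0 (Set.mem_singleton _), hf1 (Set.mem_singleton _)] at h2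
    simp at h2

end PeterWeyl

/-! ### Irreducible representations separate points. -/

section Separation

variable {G : Type u} [Group G] [TopologicalSpace G]

theorem URep.apply_eq_one_of_dual {s : G} (h : ∀ π : Dual G, π.rep s = 1) (n : ℕ) :
    ∀ ρ : URep G (Fin n), (ρ s : Matrix (Fin n) (Fin n) ℂ) = 1 := by
  induction n using Nat.strong_induction_on with
  | _ n ih =>
    intro ρ
    by_cases hρ : ρ.toRepresentation.IsIrreducible
    · obtain ⟨π, V, -, h2, h3⟩ := exists_dual_equiv ρ hρ
      have h4 := h3 s
      rw [h π, Matrix.UnitaryGroup.one_val, Matrix.mul_one] at h4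
      rw [← Matrix.mul_one (ρ s : Matrix (Fin n) (Fin n) ℂ), ← h2, ← Matrix.mul_assoc, h4]
    · rcases Nat.eq_zero_or_pos n with rfl | hn
      · exact Subsingleton.elim _ _
      · obtain ⟨k, l, σ, τ, V, W, hk, hl, -, -, hV, hW, hVW⟩ := ρ.exists_split hn hρ
        have h1 := hV s
        have h2 := hW s
        rw [ih k hk σ, Matrix.mul_one] at h1
        rw [ih l hl τ, Matrix.mul_one] at h2
        rw [← Matrix.mul_one (ρ s : Matrix (Fin n) (Fin n) ℂ), ← hVW, Matrix.mul_add,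
          ← Matrix.mul_assoc, ← Matrix.mul_assoc, h1, h2]

/-- The irreducible representations of a compact group separate its points. -/
theorem exists_dual_apply_ne [IsTopologicalGroup G] [CompactSpace G] [T2Space G] {s t : G}
    (hst : s ≠ t) : ∃ π : Dual G, π.rep s ≠ π.rep t := by
  by_contra! h
  have hne : s⁻¹ * t ≠ 1 := fun h => hst (inv_mul_eq_one.mp h)
  obtain ⟨n, ρ, hρ⟩ := exists_uRep_ne_one hne
  refine hρ (Subtype.ext (URep.apply_eq_one_of_dual (fun π => ?_) n ρ))
  rw [map_mul, map_inv, h, inv_mul_cancel]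

end Separation

/-! ### Mutually inverse contractions. -/

section Contractions

variable {n : Type*} [Fintype n] [DecidableEq n]

/-- A contraction whose inverse is a contraction is unitary. -/
theorem eq_conjTranspose_of_contraction {P Q : Matrix n n ℂ}
    (hP : ∀ x y, ‖star y ⬝ᵥ P.mulVec x‖ ≤ l2 x * l2 y)
    (hQ : ∀ x y, ‖star y ⬝ᵥ Q.mulVec x‖ ≤ l2 x * l2 y) (hPQ : P * Q = 1) :
    Q = P.conjTranspose := by
  have le_of : ∀ {a b : ℝ}, 0 ≤ a → 0 ≤ b → a ^ 2 ≤ b * a → a ≤ b := fun ha hb h => by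
    nlinarith
  refine Matrix.ext_of_mulVec_single fun i => ?_
  set x : n → ℂ := Pi.single i 1
  set p := P.conjTranspose.mulVec x
  set q := Q.mulVec x
  have norm_sq : ∀ z : n → ℂ, ‖star z ⬝ᵥ z‖ = l2 z ^ 2 := fun z => by
    rw [star_dotProduct_self, Complex.norm_real, Real.norm_of_nonneg (sq_nonneg _)]
  have adj : ∀ z, star p ⬝ᵥ z = star x ⬝ᵥ P.mulVec z := fun z => by
    rw [Matrix.star_mulVec, Matrix.conjTranspose_conjTranspose, ← Matrix.dotProduct_mulVec]
  have hq : l2 q ≤ l2 x := le_of (l2_nonneg _) (l2_nonneg _) (by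
    rw [← norm_sq q]
    exact hQ x q)
  have hp : l2 p ≤ l2 x := le_of (l2_nonneg _) (l2_nonneg _) (by
    rw [← norm_sq p, adj, mul_comm]
    exact hP p x)
  have hpq : star p ⬝ᵥ q = ((l2 x ^ 2 : ℝ) : ℂ) := by
    rw [adj, Matrix.mulVec_mulVec, hPQ, Matrix.one_mulVec, star_dotProduct_self]
  have hqp : star q ⬝ᵥ p = ((l2 x ^ 2 : ℝ) : ℂ) := by
    rw [Matrix.star_dotProduct, hpq, RCLike.star_def, Complex.conj_ofReal]
  -- With p = P*x and q = Qx, ⟨p, q⟩ = ⟨x, PQx⟩ = ‖x‖², while ‖p‖, ‖q‖ ≤ ‖x‖; this is equality in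
  -- Cauchy–Schwarz, and the right-hand side is at most 0.
  have h : l2 (q - p) ^ 2 = l2 q ^ 2 - l2 x ^ 2 - l2 x ^ 2 + l2 p ^ 2 := by
    have h1 := star_dotProduct_self (q - p)
    rw [star_sub, sub_dotProduct, dotProduct_sub, dotProduct_sub, hpq, hqp, star_dotProduct_self,
      star_dotProduct_self] at h1
    have h2 : ((l2 q ^ 2 - l2 x ^ 2 - (l2 x ^ 2 - l2 p ^ 2) : ℝ) : ℂ) = ((l2 (q - p) ^ 2 : ℝ) : ℂ) :=
      by rw [← h1]; push_cast; rfl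
    have h3 := Complex.ofReal_injective h2
    linarith
  have h0 : l2 (q - p) = 0 := by
    have := l2_nonneg p
    have := l2_nonneg q
    have : l2 (q - p) ^ 2 ≤ 0 := by nlinarith
    nlinarith [sq_nonneg (l2 (q - p))]
  have h1 : WithLp.toLp 2 (q - p) = 0 := norm_eq_zero.mp h0
  exact sub_eq_zero.mp (congrArg WithLp.ofLp h1)

end Contractions

/-! ### Characters are contractive, unitary on matrix entries, and self-adjoint. -/

section Characters

variable {G : Type u} [Group G] [TopologicalSpace G]
variable {ω : Dual G → ℝ} {hw : IsWeight ω} {hω : ∀ π, 1 ≤ ω π}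

/-- The matrix coefficients, as elements of the algebra. -/
noncomputable def coefA (hw : IsWeight ω) (hω : ∀ π, 1 ≤ ω π) (π : Dual G) (x y : Fin π.dim → ℂ) :
    beurlingFourierAlgebra ω hw hω :=
  ⟨⟨coef π.rep x y, continuous_coef _ _ _⟩, _, NormLE.of_dual π x y⟩

/-- The matrix entries, as elements of the algebra. -/
noncomputable def entryA (hw : IsWeight ω) (hω : ∀ π, 1 ≤ ω π) (π : Dual G) (i j : Fin π.dim) :
    beurlingFourierAlgebra ω hw hω :=
  coefA hw hω π (Pi.single j 1) (Pi.single i 1)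

theorem algebra_ext {u v : beurlingFourierAlgebra ω hw hω} (h : ∀ s, u.1 s = v.1 s) : u = v :=
  Subtype.ext (ContinuousMap.ext h)

theorem coefA_apply (π : Dual G) (x y : Fin π.dim → ℂ) (s : G) :
    (coefA hw hω π x y).1 s = coef π.rep x y s := rfl

theorem entryA_apply (π : Dual G) (i j : Fin π.dim) (s : G) :
    (entryA hw hω π i j).1 s = (π.rep s : Matrix _ _ ℂ) i j := by
  rw [entryA, coefA_apply, coef_single]

theorem coe_sum_apply {ι : Type*} (F : Finset ι) (f : ι → beurlingFourierAlgebra ω hw hω) (s : G) :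
    (∑ i ∈ F, f i).1 s = ∑ i ∈ F, (f i).1 s := by
  rw [AddSubmonoidClass.coe_finsetSum, ContinuousMap.sum_apply]

theorem coefA_eq_sum (π : Dual G) (x y : Fin π.dim → ℂ) :
    coefA hw hω π x y = ∑ i, ∑ j, (star (y i) * x j) • entryA hw hω π i j := by
  refine algebra_ext fun s => ?_
  rw [coe_sum_apply]
  simp only [coe_sum_apply]
  change coef π.rep x y s = ∑ i, ∑ j, (star (y i) * x j) * (entryA hw hω π i j).1 s
  simp only [coef, dotProduct, Matrix.mulVec, Finset.mul_sum, entryA_apply, Pi.star_apply]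
  exact Finset.sum_congr rfl fun a _ => Finset.sum_congr rfl fun c _ => by ring

/-- The algebra carries no norm here; boundedness against the gauge replaces continuity. The
remainder after a finite set of terms has as gauge bound the tail of the cost series, which tends to
0. -/
theorem hasSum_map_coefA (L : beurlingFourierAlgebra ω hw hω →ₗ[ℂ] ℂ) {K : ℝ}
    (hL : ∀ u C, NormLE ω u.1 C → ‖L u‖ ≤ K * C) {u : beurlingFourierAlgebra ω hw hω} {I : Type u}
    {π : I → Dual G} {x y : ∀ i, Fin (π i).dim → ℂ} {S : ℝ}
    (h1 : HasSum (fun i => l2 (x i) * l2 (y i) * ω (π i)) S)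
    (h2 : ∀ s, HasSum (fun i => coef (π i).rep (x i) (y i) s) (u.1 s)) :
    HasSum (fun i => L (coefA hw hω (π i) (x i) (y i))) (L u) := by
  have key : ∀ F : Finset I, ‖L u - ∑ i ∈ F, L (coefA hw hω (π i) (x i) (y i))‖
      ≤ K * (S - ∑ i ∈ F, l2 (x i) * l2 (y i) * ω (π i)) := by
    intro F
    rw [← map_sum, ← map_sub]
    refine hL _ _ ⟨{i // i ∉ F}, fun i => π i, fun i => x i, fun i => y i, _, le_rfl, ?_, fun s => ?_⟩
    · exact (Finset.hasSum_compl_iff (f := fun i => l2 (x i) * l2 (y i) * ω (π i)) F).mpr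
        (by rwa [sub_add_cancel])
    · refine (Finset.hasSum_compl_iff (f := fun i => coef (π i).rep (x i) (y i) s) F).mpr ?_
      have h3 : (u - ∑ i ∈ F, coefA hw hω (π i) (x i) (y i)).1 s
          = u.1 s - ∑ i ∈ F, coef (π i).rep (x i) (y i) s := by
        change u.1 s - (∑ i ∈ F, coefA hw hω (π i) (x i) (y i)).1 s = _
        rw [coe_sum_apply]
        rfl
      rw [h3, sub_add_cancel]
      exact h2 s
  rw [HasSum, tendsto_iff_norm_sub_tendsto_zero]
  refine squeeze_zero (fun _ => norm_nonneg _) (fun F => ?_)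
    (g := fun F => K * (S - ∑ i ∈ F, l2 (x i) * l2 (y i) * ω (π i))) ?_
  · rw [norm_sub_rev]
    exact key F
  · have h3 := (tendsto_const_nhds (x := S)).sub h1
    simpa using h3.const_mul K

theorem linearMap_eq_zero_of_entryA (L : beurlingFourierAlgebra ω hw hω →ₗ[ℂ] ℂ) {K : ℝ}
    (hL : ∀ u C, NormLE ω u.1 C → ‖L u‖ ≤ K * C) (h : ∀ π i j, L (entryA hw hω π i j) = 0)
    (u : beurlingFourierAlgebra ω hw hω) : L u = 0 := by
  obtain ⟨C, I, π, x, y, S, -, h1, h2⟩ := u.2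
  refine (hasSum_map_coefA L hL h1 h2).unique ?_
  simp [coefA_eq_sum, h, hasSum_zero]

/-- Characters are contractive. -/
theorem norm_character_le (ψ : beurlingFourierAlgebra ω hw hω →ₐ[ℂ] ℂ)
    (u : beurlingFourierAlgebra ω hw hω) (C : ℝ) (hu : NormLE ω u.1 C) : ‖ψ u‖ ≤ C := by
  by_contra! hlt
  have hC := hu.nonneg hω
  have hpos : 0 < ‖ψ u‖ := hC.trans_lt hlt
  have hne : ψ u ≠ 0 := norm_pos_iff.mp hpos
  have hw' : NormLE ω ((ψ u)⁻¹ • u).1 (‖(ψ u)⁻¹‖ * C) := hu.const_mul (ψ u)⁻¹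
  have hlt1 : ‖(ψ u)⁻¹‖ * C < 1 := by
    rw [norm_inv, inv_mul_lt_one₀ hpos]
    exact hlt
  -- For w = u/ψ(u), of gauge below 1, the series yields v = w + wv in the algebra; applying ψ gives
  -- ψ(v) = 1 + ψ(v).
  obtain ⟨v, D, hv, heq⟩ := hw'.exists_neumann hω hw hlt1
  let v' : beurlingFourierAlgebra ω hw hω := ⟨⟨v, hv.continuous hω⟩, D, hv⟩
  have h1 : v' = (ψ u)⁻¹ • u + ((ψ u)⁻¹ • u) * v' := algebra_ext heq
  have h2 := congrArg ψ h1
  rw [map_add, map_mul, map_smul, smul_eq_mul, inv_mul_cancel₀ hne, one_mul] at h2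
  simp at h2

/-- The real `sSup` of an unbounded set is 0, and 0^{1/n} = 0 for n > 0, which is excluded for large
n by the limit 1. Finiteness of the set of constituents is thus not needed. -/
theorem eventually_bddAbove (hne : IsNonexponential ω) (π : Dual G) :
    ∀ᶠ n : ℕ in atTop, BddAbove (ω '' {σ : Dual G | σ.rep.Sub (π.rep.tensorPow n)}) := by
  filter_upwards [(hne π).eventually_ne one_ne_zero, eventually_gt_atTop 0] with n hn hn0
  by_contra hb
  apply hn
  rw [weightOf, Real.sSup_of_not_bddAbove hb, Real.zero_rpow]
  have : (n : ℝ) ≠ 0 := Nat.cast_ne_zero.mpr hn0.ne'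
  positivity

/-- The spectral radius argument: contractivity applied to the n-th power, then n-th roots. In the
limit the weight disappears from the bound. -/
theorem norm_character_coefA_le (hne : IsNonexponential ω)
    (ψ : beurlingFourierAlgebra ω hw hω →ₐ[ℂ] ℂ) (π : Dual G) (x y : Fin π.dim → ℂ) :
    ‖ψ (coefA hw hω π x y)‖ ≤ l2 x * l2 y := by
  have hlim := (hne π).const_mul (l2 x * l2 y)
  rw [mul_one] at hlim
  have hd : 0 ≤ l2 x * l2 y := mul_nonneg (l2_nonneg x) (l2_nonneg y)
  refine ge_of_tendsto hlim ?_
  filter_upwards [eventually_bddAbove hne π, eventually_gt_atTop 0] with n hb hn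
  have hW : 0 ≤ weightOf ω (π.rep.tensorPow n) :=
    Real.sSup_nonneg (by rintro _ ⟨σ, -, rfl⟩; exact (hw.1 σ).le)
  have h1 := NormLE.of_uRep hω (π.rep.tensorPow n) hW (fun σ hσ => le_csSup hb ⟨σ, hσ, rfl⟩)
    (fun p => ∏ l, x (p l)) (fun p => ∏ l, y (p l))
  rw [l2_tensorPow, l2_tensorPow, ← mul_pow] at h1
  have h2 : NormLE ω (coefA hw hω π x y ^ n).1
      ((l2 x * l2 y) ^ n * weightOf ω (π.rep.tensorPow n)) := by
    convert h1 using 1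
    funext s
    rw [coef_tensorPow]
    rfl
  have h3 := norm_character_le ψ _ _ h2
  rw [map_pow, norm_pow] at h3
  have h4 := Real.rpow_le_rpow (by positivity) h3 (z := 1 / (n : ℝ)) (by positivity)
  rwa [Real.mul_rpow (by positivity) hW, one_div, Real.pow_rpow_inv_natCast (norm_nonneg _) hn.ne',
    Real.pow_rpow_inv_natCast hd hn.ne', ← one_div] at h4

/-- The matrix `(ψ(π_{ij}))`. -/
noncomputable def charMatrix (ψ : beurlingFourierAlgebra ω hw hω →ₐ[ℂ] ℂ) (π : Dual G) :
    Matrix (Fin π.dim) (Fin π.dim) ℂ := Matrix.of fun i j => ψ (entryA hw hω π i j)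

theorem character_coefA (ψ : beurlingFourierAlgebra ω hw hω →ₐ[ℂ] ℂ) (π : Dual G)
    (x y : Fin π.dim → ℂ) :
    ψ (coefA hw hω π x y) = star y ⬝ᵥ (charMatrix ψ π).mulVec x := by
  rw [coefA_eq_sum]
  simp only [map_sum, map_smul, dotProduct, Matrix.mulVec, Finset.mul_sum, smul_eq_mul,
    Pi.star_apply, charMatrix, Matrix.of_apply]
  exact Finset.sum_congr rfl fun a _ => Finset.sum_congr rfl fun c _ => by ring

theorem character_smul (ψ : beurlingFourierAlgebra ω hw hω →ₐ[ℂ] ℂ) (c : ℂ)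
    (u : beurlingFourierAlgebra ω hw hω) : ψ (c • u) = c * ψ u :=
  map_smul ψ c u

variable [IsTopologicalGroup G]

/-- Complex conjugation on the algebra of a symmetric weight. -/
noncomputable def starA (hsymm : IsSymmetricWeight ω) (u : beurlingFourierAlgebra ω hw hω) :
    beurlingFourierAlgebra ω hw hω :=
  ⟨star u.1, u.2.choose, u.2.choose_spec.star hω hsymm⟩

theorem starA_apply (hsymm : IsSymmetricWeight ω) (u : beurlingFourierAlgebra ω hw hω) (s : G) :
    (starA hsymm u).1 s = star (u.1 s) := rfl

/-- A conjugated coefficient of π is a coefficient of the class of π̄, to which the previous bound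
applies. -/
theorem norm_character_starA_coefA_le (hne : IsNonexponential ω) (hsymm : IsSymmetricWeight ω)
    (ψ : beurlingFourierAlgebra ω hw hω →ₐ[ℂ] ℂ) (π : Dual G) (x y : Fin π.dim → ℂ) :
    ‖ψ (starA hsymm (coefA hw hω π x y))‖ ≤ l2 x * l2 y := by
  obtain ⟨σ, V, -, h2, h3⟩ := exists_dual_conj π
  have h : starA hsymm (coefA hw hω π x y) = coefA hw hω σ (V.conjTranspose.mulVec (star x))
      (V.conjTranspose.mulVec (star y)) := by
    refine algebra_ext fun s => ?_
    rw [starA_apply, coefA_apply, coefA_apply, coef_of_intertwining h3, h2, Matrix.one_mulVec,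
      coef_conj]
  rw [h]
  refine (norm_character_coefA_le hne ψ σ _ _).trans_eq ?_
  rw [l2_conjTranspose_mulVec h2, l2_conjTranspose_mulVec h2, l2_star, l2_star]

theorem character_starA_coefA (hsymm : IsSymmetricWeight ω)
    (ψ : beurlingFourierAlgebra ω hw hω →ₐ[ℂ] ℂ) (π : Dual G) (x y : Fin π.dim → ℂ) :
    ψ (starA hsymm (coefA hw hω π x y)) = star (star y) ⬝ᵥ
      (Matrix.of fun i j => ψ (starA hsymm (entryA hw hω π i j))).mulVec (star x) := by
  have h : starA hsymm (coefA hw hω π x y)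
      = ∑ i, ∑ j, (y i * star (x j)) • starA hsymm (entryA hw hω π i j) := by
    refine algebra_ext fun s => ?_
    rw [starA_apply, coefA_eq_sum, coe_sum_apply, coe_sum_apply, star_sum]
    simp only [coe_sum_apply, star_sum]
    refine Finset.sum_congr rfl fun a _ => Finset.sum_congr rfl fun c _ => ?_
    change star ((star (y a) * x c) * (entryA hw hω π a c).1 s)
      = y a * star (x c) * star ((entryA hw hω π a c).1 s)
    simp only [star_mul', star_star]
  rw [h]
  simp only [map_sum, map_smul, dotProduct, Matrix.mulVec, Finset.mul_sum, smul_eq_mul,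
    Pi.star_apply, star_star, Matrix.of_apply]
  exact Finset.sum_congr rfl fun a _ => Finset.sum_congr rfl fun c _ => by ring

/-- ψ applied to the unitarity relations ∑ₖ π_{ik} conj(π_{jk}) = δ_{ij}. -/
theorem charMatrix_mul_transpose (hsymm : IsSymmetricWeight ω)
    (ψ : beurlingFourierAlgebra ω hw hω →ₐ[ℂ] ℂ) (π : Dual G) :
    charMatrix ψ π * (Matrix.of fun i j => ψ (starA hsymm (entryA hw hω π i j))).transpose = 1 := by
  ext i j
  have h : ∑ k, entryA hw hω π i k * starA hsymm (entryA hw hω π j k)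
      = (1 : Matrix (Fin π.dim) (Fin π.dim) ℂ) i j • 1 := by
    refine algebra_ext fun s => ?_
    rw [coe_sum_apply]
    change ∑ k, (entryA hw hω π i k).1 s * star ((entryA hw hω π j k).1 s)
      = (1 : Matrix (Fin π.dim) (Fin π.dim) ℂ) i j * 1
    simp only [entryA_apply]
    rw [mul_one, ← π.rep.mul_conjTranspose s, Matrix.mul_apply]
    rfl
  have h2 := congrArg ψ h
  rw [map_sum, map_smul, map_one, smul_eq_mul, mul_one] at h2
  rw [← h2, Matrix.mul_apply]
  exact Finset.sum_congr rfl fun k _ => (map_mul ψ _ _).symm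

/-- The matrices of a character are unitary. -/
theorem transpose_eq_conjTranspose_charMatrix (hne : IsNonexponential ω)
    (hsymm : IsSymmetricWeight ω) (ψ : beurlingFourierAlgebra ω hw hω →ₐ[ℂ] ℂ) (π : Dual G) :
    (Matrix.of fun i j => ψ (starA hsymm (entryA hw hω π i j))).transpose
      = (charMatrix ψ π).conjTranspose := by
  refine eq_conjTranspose_of_contraction (fun x y => ?_) (fun x y => ?_)
    (charMatrix_mul_transpose hsymm ψ π)
  · rw [← character_coefA]
    exact norm_character_coefA_le hne ψ π x y
  · have h := norm_character_starA_coefA_le hne hsymm ψ π y x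
    rw [character_starA_coefA] at h
    rw [Matrix.mulVec_transpose, dotProduct_comm, ← Matrix.dotProduct_mulVec, mul_comm]
    simpa using h

theorem charMatrix_isUnitary (hne : IsNonexponential ω) (hsymm : IsSymmetricWeight ω)
    (ψ : beurlingFourierAlgebra ω hw hω →ₐ[ℂ] ℂ) (π : Dual G) :
    (charMatrix ψ π).conjTranspose * charMatrix ψ π = 1 := by
  rw [← transpose_eq_conjTranspose_charMatrix hne hsymm, mul_eq_one_comm]
  exact charMatrix_mul_transpose hsymm ψ π

/-- Characters are self-adjoint. -/
theorem character_starA (hne : IsNonexponential ω) (hsymm : IsSymmetricWeight ω)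
    (ψ : beurlingFourierAlgebra ω hw hω →ₐ[ℂ] ℂ) (u : beurlingFourierAlgebra ω hw hω) :
    ψ (starA hsymm u) = star (ψ u) := by
  let L : beurlingFourierAlgebra ω hw hω →ₗ[ℂ] ℂ :=
    { toFun := fun u => star (ψ (starA hsymm u)) - ψ u
      map_add' := fun u v => by
        have h : starA hsymm (u + v) = starA hsymm u + starA hsymm v :=
          algebra_ext fun s => star_add _ _
        rw [h, map_add, map_add, star_add]
        ring
      map_smul' := fun c u => by
        have h : starA hsymm (c • u) = star c • starA hsymm u :=
          algebra_ext fun s => star_mul' _ _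
        rw [h, map_smul, map_smul, smul_eq_mul, star_mul', star_star, RingHom.id_apply,
          smul_eq_mul, smul_eq_mul]
        ring }
  have h : L u = 0 := by
    refine linearMap_eq_zero_of_entryA L (K := 2) (fun u C hu => ?_) (fun π i j => ?_) u
    · refine (norm_sub_le _ _).trans ?_
      rw [norm_star, two_mul]
      exact add_le_add (norm_character_le ψ (starA hsymm u) C (hu.star hω hsymm))
        (norm_character_le ψ u C hu)
    · have h := congrFun (congrFun (transpose_eq_conjTranspose_charMatrix hne hsymm ψ π) j) i
      change ψ (starA hsymm (entryA hw hω π i j)) = star (ψ (entryA hw hω π i j)) at h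
      change star (ψ (starA hsymm (entryA hw hω π i j))) - ψ (entryA hw hω π i j) = 0
      rw [h, star_star, sub_self]
  rw [← star_star (ψ (starA hsymm u)), sub_eq_zero.mp h]

end Characters

/-! ### Every character is a point evaluation. -/

section Spectrum

open MeasureTheory

variable {G : Type u} [Group G] [TopologicalSpace G] [IsTopologicalGroup G]
variable {ω : Dual G → ℝ} {hw : IsWeight ω} {hω : ∀ π, 1 ≤ ω π}

/-- Right translation on the algebra. -/
noncomputable def translateA (hw : IsWeight ω) (hω : ∀ π, 1 ≤ ω π) (t : G) :
    beurlingFourierAlgebra ω hw hω →ₐ[ℂ] beurlingFourierAlgebra ω hw hω where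
  toFun u := ⟨⟨fun s => u.1 (s * t), u.1.continuous.comp (continuous_mul_const t)⟩,
    u.2.choose, u.2.choose_spec.translate t⟩
  map_one' := rfl
  map_mul' _ _ := rfl
  map_zero' := rfl
  map_add' _ _ := rfl
  commutes' _ := rfl

theorem translateA_apply (u : beurlingFourierAlgebra ω hw hω) (s t : G) :
    (translateA hw hω t u).1 s = u.1 (s * t) := rfl

theorem translateA_coefA (π : Dual G) (x y : Fin π.dim → ℂ) (t : G) :
    translateA hw hω t (coefA hw hω π x y)
      = coefA hw hω π ((π.rep t : Matrix (Fin π.dim) (Fin π.dim) ℂ).mulVec x) y :=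
  algebra_ext fun s => coef_mul_right π.rep x y s t

theorem character_translateA_coefA (ψ : beurlingFourierAlgebra ω hw hω →ₐ[ℂ] ℂ) (π : Dual G)
    (x y : Fin π.dim → ℂ) (t : G) :
    ψ (translateA hw hω t (coefA hw hω π x y))
      = star y ⬝ᵥ (charMatrix ψ π * (π.rep t : Matrix (Fin π.dim) (Fin π.dim) ℂ)).mulVec x := by
  rw [translateA_coefA, character_coefA, Matrix.mulVec_mulVec]

theorem character_translateA_entryA (ψ : beurlingFourierAlgebra ω hw hω →ₐ[ℂ] ℂ) (π : Dual G)
    (i j : Fin π.dim) (t : G) :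
    ψ (translateA hw hω t (entryA hw hω π i j))
      = (charMatrix ψ π * (π.rep t : Matrix (Fin π.dim) (Fin π.dim) ℂ)) i j := by
  rw [entryA, character_translateA_coefA]
  simp

/-- On coefficients the orbit function is visibly continuous. The general case is a uniformly
convergent series, since translation preserves the gauge. -/
theorem continuous_character_translateA (ψ : beurlingFourierAlgebra ω hw hω →ₐ[ℂ] ℂ)
    (u : beurlingFourierAlgebra ω hw hω) : Continuous fun t => ψ (translateA hw hω t u) := by
  obtain ⟨C, I, π, x, y, S, -, h1, h2⟩ := u.2
  have h3 : ∀ t, HasSum (fun i => ψ (translateA hw hω t (coefA hw hω (π i) (x i) (y i))))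
      (ψ (translateA hw hω t u)) := fun t =>
    hasSum_map_coefA (ψ.comp (translateA hw hω t)).toLinearMap (K := 1) (fun u C hu => by
      rw [one_mul]
      exact norm_character_le ψ (translateA hw hω t u) C (hu.translate t)) h1 h2
  simp only [← fun t => (h3 t).tsum_eq]
  refine continuous_tsum (fun i => ?_) h1.summable fun i t =>
    norm_character_le ψ _ _ ((NormLE.of_dual (π i) (x i) (y i)).translate t)
  simp only [character_translateA_coefA, ← Matrix.mulVec_mulVec]
  have h : Continuous fun s => ((π i).rep s : Matrix (Fin (π i).dim) (Fin (π i).dim) ℂ) :=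
    continuous_subtype_val.comp (π i).rep.continuous_toFun
  exact continuous_const.dotProduct
    (continuous_const.matrix_mulVec (h.matrix_mulVec continuous_const))

theorem character_translateA_add (ψ : beurlingFourierAlgebra ω hw hω →ₐ[ℂ] ℂ)
    (u v : beurlingFourierAlgebra ω hw hω) (t : G) :
    ψ (translateA hw hω t (u + v)) = ψ (translateA hw hω t u) + ψ (translateA hw hω t v) :=
  map_add (ψ.comp (translateA hw hω t)) u v

/-- The homomorphism `u ↦ (u, t ↦ ψ(u(· t)))` to the functions on `G ⊔ G`. -/
noncomputable def orbitHom (ψ : beurlingFourierAlgebra ω hw hω →ₐ[ℂ] ℂ) :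
    beurlingFourierAlgebra ω hw hω →ₐ[ℂ] C(G ⊕ G, ℂ) where
  toFun u := ⟨Sum.elim (fun s => u.1 s) (fun t => ψ (translateA hw hω t u)),
    u.1.continuous.sumElim (continuous_character_translateA ψ u)⟩
  map_one' := ContinuousMap.ext <| by
    rintro (s | t)
    exacts [rfl, map_one (ψ.comp (translateA hw hω t))]
  map_mul' u v := ContinuousMap.ext <| by
    rintro (s | t)
    exacts [rfl, map_mul (ψ.comp (translateA hw hω t)) u v]
  map_zero' := ContinuousMap.ext <| by
    rintro (s | t)
    exacts [rfl, map_zero (ψ.comp (translateA hw hω t))]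
  map_add' u v := ContinuousMap.ext <| by
    rintro (s | t)
    exacts [rfl, map_add (ψ.comp (translateA hw hω t)) u v]
  commutes' c := ContinuousMap.ext <| by
    rintro (s | t)
    exacts [rfl, (ψ.comp (translateA hw hω t)).commutes c]

theorem orbitHom_inl (ψ : beurlingFourierAlgebra ω hw hω →ₐ[ℂ] ℂ)
    (u : beurlingFourierAlgebra ω hw hω) (s : G) : orbitHom ψ u (Sum.inl s) = u.1 s := rfl

theorem orbitHom_inr (ψ : beurlingFourierAlgebra ω hw hω →ₐ[ℂ] ℂ)
    (u : beurlingFourierAlgebra ω hw hω) (t : G) :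
    orbitHom ψ u (Sum.inr t) = ψ (translateA hw hω t u) := rfl

theorem orbitHom_starA (hne : IsNonexponential ω) (hsymm : IsSymmetricWeight ω)
    (ψ : beurlingFourierAlgebra ω hw hω →ₐ[ℂ] ℂ) (u : beurlingFourierAlgebra ω hw hω) :
    orbitHom ψ (starA hsymm u) = star (orbitHom ψ u) := by
  ext (s | t)
  · rfl
  · rw [ContinuousMap.star_apply, orbitHom_inr, orbitHom_inr, ← character_starA hne hsymm]
    rfl

variable [CompactSpace G]

/-- Convolving a character with the Haar measure gives the Haar measure. -/
theorem integral_character_translateA [MeasurableSpace G] [BorelSpace G] (μ : Measure G)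
    [IsProbabilityMeasure μ] [μ.IsMulLeftInvariant]
    (ψ : beurlingFourierAlgebra ω hw hω →ₐ[ℂ] ℂ) (u : beurlingFourierAlgebra ω hw hω) :
    ∫ t, ψ (translateA hw hω t u) ∂μ = ∫ t, u.1 t ∂μ := by
  have hi1 : ∀ u, Integrable (fun t => ψ (translateA hw hω t u)) μ := fun u =>
    integrable_of_continuous μ (continuous_character_translateA ψ u)
  have hi2 : ∀ u : beurlingFourierAlgebra ω hw hω, Integrable (fun t => u.1 t) μ := fun u =>
    integrable_of_continuous μ u.1.continuous
  let L : beurlingFourierAlgebra ω hw hω →ₗ[ℂ] ℂ :=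
    { toFun := fun u => ∫ t, ψ (translateA hw hω t u) ∂μ - ∫ t, u.1 t ∂μ
      map_add' := fun u v => by
        simp only [character_translateA_add]
        rw [integral_add (hi1 u) (hi1 v)]
        change _ - ∫ t, u.1 t + v.1 t ∂μ = _
        rw [integral_add (hi2 u) (hi2 v)]
        ring
      map_smul' := fun c u => by
        have h : ∀ t, ψ (translateA hw hω t (c • u)) = c • ψ (translateA hw hω t u) := fun t =>
          character_smul (ψ.comp (translateA hw hω t)) c u
        simp only [h, RingHom.id_apply]
        rw [integral_smul]
        change _ - ∫ t, c • u.1 t ∂μ = _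
        rw [integral_smul, smul_sub] }
  have hL : ∀ u C, NormLE ω u.1 C → ‖L u‖ ≤ 2 * C := by
    intro u C hu
    refine (norm_sub_le _ _).trans ?_
    rw [two_mul]
    refine add_le_add ?_ ?_
    · have h := norm_integral_le_of_norm_le_const (μ := μ) (C := C)
        (Eventually.of_forall fun t => norm_character_le ψ (translateA hw hω t u) C (hu.translate t))
      simpa using h
    · have h := norm_integral_le_of_norm_le_const (μ := μ) (C := C)
        (Eventually.of_forall fun t => hu.norm_le hω t)
      simpa using h
  refine sub_eq_zero.mp (linearMap_eq_zero_of_entryA L hL (fun π i j => ?_) u)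
  -- Left invariance gives π(s)P = P for all s. Applying ψ to these relations gives `charMatrix ψ π
  -- * P = P`, whose left side is the integral of the translated values.
  let P : Matrix (Fin π.dim) (Fin π.dim) ℂ := Matrix.of fun k l => ∫ t, (entryA hw hω π k l).1 t ∂μ
  have hP : ∑ k, P k j • entryA hw hω π i k = P i j • 1 := by
    refine algebra_ext fun s => ?_
    rw [coe_sum_apply]
    change ∑ k, P k j * (entryA hw hω π i k).1 s = P i j * 1
    rw [mul_one]
    change _ = ∫ t, (entryA hw hω π i j).1 t ∂μ
    rw [← integral_mul_left_eq_self (fun t => (entryA hw hω π i j).1 t) s]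
    have h : ∀ t, (entryA hw hω π i j).1 (s * t)
        = ∑ k, (entryA hw hω π k j).1 t * (entryA hw hω π i k).1 s := fun t => by
      simp only [entryA_apply, map_mul, Matrix.UnitaryGroup.mul_val, Matrix.mul_apply]
      exact Finset.sum_congr rfl fun k _ => mul_comm _ _
    simp only [h]
    rw [integral_finsetSum _ fun k _ => (hi2 _).mul_const _]
    exact Finset.sum_congr rfl fun k _ => (integral_mul_const _ _).symm
  have h1 := congrArg ψ hP
  rw [map_sum, character_smul, map_one, mul_one] at h1
  change ∫ t, ψ (translateA hw hω t (entryA hw hω π i j)) ∂μ - P i j = 0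
  rw [← h1, sub_eq_zero]
  have h2 : ∀ t, ψ (translateA hw hω t (entryA hw hω π i j))
      = ∑ k, ψ (entryA hw hω π i k) * (entryA hw hω π k j).1 t := fun t => by
    rw [character_translateA_entryA, Matrix.mul_apply]
    exact Finset.sum_congr rfl fun k _ => by rw [entryA_apply]; rfl
  simp only [h2]
  rw [integral_finsetSum _ fun k _ => (hi2 _).const_mul _]
  refine Finset.sum_congr rfl fun k _ => ?_
  rw [integral_const_mul, character_smul, mul_comm]
  rfl

theorem exists_apply_ne [T2Space G] (hw : IsWeight ω) (hω : ∀ π, 1 ≤ ω π) {s t : G} (hst : s ≠ t) :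
    ∃ (π : Dual G) (i j : Fin π.dim), (entryA hw hω π i j).1 s ≠ (entryA hw hω π i j).1 t := by
  obtain ⟨π, hπ⟩ := exists_dual_apply_ne hst
  by_contra! h
  refine hπ (Subtype.ext (Matrix.ext fun i j => ?_))
  rw [← entryA_apply (hw := hw) (hω := hω), h, entryA_apply]

/-- If s in the first copy and t in the second were not separated, ψ would be evaluation at st⁻¹.
Within the second copy, the unitary matrices of ψ can be cancelled, leaving separation in G. -/
theorem orbitHom_separatesPoints [T2Space G] (hne : IsNonexponential ω)
    (hsymm : IsSymmetricWeight ω) (ψ : beurlingFourierAlgebra ω hw hω →ₐ[ℂ] ℂ)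
    (hψ : ∀ s, ∃ u, ψ u ≠ u.1 s) {a b : G ⊕ G} (hab : a ≠ b) :
    ∃ u, orbitHom ψ u a ≠ orbitHom ψ u b := by
  have mixed : ∀ s t, ∃ u, orbitHom ψ u (Sum.inl s) ≠ orbitHom ψ u (Sum.inr t) := by
    intro s t
    obtain ⟨u, hu⟩ := hψ (s * t⁻¹)
    refine ⟨translateA hw hω t⁻¹ u, ?_⟩
    rw [orbitHom_inl, orbitHom_inr, translateA_apply]
    have h : translateA hw hω t (translateA hw hω t⁻¹ u) = u := algebra_ext fun r => by
      rw [translateA_apply, translateA_apply, mul_inv_cancel_right]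
    rw [h]
    exact hu.symm
  rcases a with s | t <;> rcases b with s' | t'
  · obtain ⟨π, i, j, h⟩ := exists_apply_ne hw hω (s := s) (t := s') fun h => hab (h ▸ rfl)
    exact ⟨entryA hw hω π i j, h⟩
  · exact mixed s t'
  · obtain ⟨u, hu⟩ := mixed s' t
    exact ⟨u, hu.symm⟩
  · obtain ⟨π, hπ⟩ := exists_dual_apply_ne (s := t) (t := t') fun h => hab (h ▸ rfl)
    by_contra! h
    refine hπ (Subtype.ext ?_)
    have h1 : charMatrix ψ π * (π.rep t : Matrix (Fin π.dim) (Fin π.dim) ℂ)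
        = charMatrix ψ π * (π.rep t' : Matrix (Fin π.dim) (Fin π.dim) ℂ) := by
      ext i j
      rw [← character_translateA_entryA, ← character_translateA_entryA]
      exact h (entryA hw hω π i j)
    rw [← Matrix.one_mul (π.rep t : Matrix (Fin π.dim) (Fin π.dim) ℂ), ← charMatrix_isUnitary hne hsymm ψ π,
      Matrix.mul_assoc, h1, ← Matrix.mul_assoc, charMatrix_isUnitary hne hsymm ψ π, Matrix.one_mul]

/-- Every character is a point evaluation. -/
theorem exists_character_eq_eval [T2Space G] (hne : IsNonexponential ω)
    (hsymm : IsSymmetricWeight ω) (ψ : beurlingFourierAlgebra ω hw hω →ₐ[ℂ] ℂ) :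
    ∃ s, ∀ u, ψ u = u.1 s := by
  by_contra! hψ
  borelize G
  obtain ⟨μ, _, _, _, _⟩ := exists_haar_isProbabilityMeasure (G := G)
  let B : StarSubalgebra ℂ C(G ⊕ G, ℂ) :=
    { (orbitHom ψ).range with
      star_mem' := by
        rintro _ ⟨u, rfl⟩
        exact ⟨starA hsymm u, orbitHom_starA hne hsymm ψ u⟩ }
  have hB : B.SeparatesPoints := fun a b hab => by
    obtain ⟨u, hu⟩ := orbitHom_separatesPoints hne hsymm ψ hψ hab
    exact ⟨_, ⟨orbitHom ψ u, ⟨u, rfl⟩, rfl⟩, hu⟩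
  have htop := ContinuousMap.starSubalgebra_topologicalClosure_eq_top_of_separatesPoints B hB
  let g : C(G ⊕ G, ℂ) := ⟨Sum.elim (fun _ => 0) (fun _ => 1),
    continuous_const.sumElim continuous_const⟩
  have hg : g ∈ B.topologicalClosure := htop ▸ StarSubalgebra.mem_top
  -- The common integral of the two halves would lie within less than 1/2 of both 0 and 1.
  obtain ⟨_, ⟨u, rfl⟩, hu⟩ := Metric.mem_closure_iff.mp hg (1 / 2) (by norm_num)
  rw [dist_comm, dist_eq_norm] at hu
  have hpt : ∀ a, ‖orbitHom ψ u a - g a‖ ≤ ‖(orbitHom ψ u : C(G ⊕ G, ℂ)) - g‖ := fun a =>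
    ContinuousMap.norm_coe_le_norm (orbitHom ψ u - g) a
  have h1 : ‖∫ t, u.1 t ∂μ‖ < 1 / 2 := by
    have h := norm_integral_le_of_norm_le_const (μ := μ) (f := fun t => u.1 t)
      (Eventually.of_forall fun t => by simpa [g, orbitHom_inl] using hpt (Sum.inl t))
    refine lt_of_le_of_lt ?_ hu
    simpa using h
  have h2 : ‖(∫ t, ψ (translateA hw hω t u) ∂μ) - 1‖ < 1 / 2 := by
    have h := norm_integral_le_of_norm_le_const (μ := μ)
      (f := fun t => ψ (translateA hw hω t u) - 1)
      (Eventually.of_forall fun t => by simpa [g, orbitHom_inr] using hpt (Sum.inr t))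
    rw [integral_sub (integrable_of_continuous μ (continuous_character_translateA ψ u))
      (integrable_const 1)] at h
    refine lt_of_le_of_lt ?_ hu
    simpa using h
  rw [integral_character_translateA μ ψ u] at h2
  have h3 := norm_sub_le (∫ t, u.1 t ∂μ) ((∫ t, u.1 t ∂μ) - 1)
  rw [sub_sub_cancel, norm_one] at h3
  linarith

/-- A continuous injection of a compact space into a Hausdorff space is a closed embedding. -/
theorem isEmbedding_evalAt [T2Space G] (hw : IsWeight ω) (hω : ∀ π, 1 ≤ ω π) :
    IsEmbedding (evalAt (beurlingFourierAlgebra ω hw hω)) := by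
  have hc : Continuous (evalAt (beurlingFourierAlgebra ω hw hω)) :=
    continuous_pi fun u => u.1.continuous
  refine (hc.isClosedEmbedding fun s t hst => ?_).isEmbedding
  by_contra hne
  obtain ⟨π, i, j, h⟩ := exists_apply_ne hw hω hne
  exact h (congrFun hst _)

theorem gelfandSpectrum_eq_range_evalAt [T2Space G] (hw : IsWeight ω) (hω : ∀ π, 1 ≤ ω π)
    (hne : IsNonexponential ω) (hsymm : IsSymmetricWeight ω) :
    gelfandSpectrum (beurlingFourierAlgebra ω hw hω)
      = Set.range (evalAt (beurlingFourierAlgebra ω hw hω)) := by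
  ext χ
  constructor
  · rintro ⟨φ, hφ, rfl⟩
    -- A nonzero multiplicative functional is unital: φ(u) = φ(u)φ(1) with φ(u) ≠ 0.
    have h1 : φ 1 = 1 := by
      obtain ⟨u, hu⟩ : ∃ u, φ u ≠ 0 := by
        by_contra! h
        exact hφ (NonUnitalAlgHom.ext h)
      have h := map_mul φ u 1
      rw [mul_one] at h
      exact (mul_eq_left₀ hu).mp h.symm
    let ψ : beurlingFourierAlgebra ω hw hω →ₐ[ℂ] ℂ :=
      { toFun := φ
        map_one' := h1
        map_mul' := map_mul φ
        map_zero' := map_zero φ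
        map_add' := φ.map_add'
        commutes' := fun c => by
          rw [Algebra.algebraMap_eq_smul_one]
          refine (φ.map_smul' c 1).trans ?_
          change c • φ 1 = c
          rw [h1, smul_eq_mul, mul_one] }
    obtain ⟨s, hs⟩ := exists_character_eq_eval hne hsymm ψ
    exact ⟨s, funext fun u => (hs u).symm⟩
  · rintro ⟨s, rfl⟩
    let φ : beurlingFourierAlgebra ω hw hω →ₙₐ[ℂ] ℂ :=
      { toFun := fun u => u.1 s
        map_smul' := fun _ _ => rfl
        map_zero' := rfl
        map_add' := fun _ _ => rfl
        map_mul' := fun _ _ => rfl }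
    refine ⟨φ, fun h => ?_, rfl⟩
    have h1 : (1 : ℂ) = 0 := congrArg (fun f => f 1) h
    exact one_ne_zero h1

end Spectrum

end BeurlingFourier

theorem mainTheorem6 {G : Type*} [Group G] [TopologicalSpace G] [IsTopologicalGroup G]
    [CompactSpace G] [T2Space G] (ω : BeurlingFourier.Dual G → ℝ)
    (hω : BeurlingFourier.IsWeight ω) (hsymm : BeurlingFourier.IsSymmetricWeight ω)
    (hnonexp : BeurlingFourier.IsNonexponential ω) :
    ∃ A : Subalgebra ℂ C(G, ℂ),
      (A : Set C(G, ℂ)) = BeurlingFourier.beurlingFourierSet ω ∧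
      IsEmbedding (BeurlingFourier.evalAt A) ∧
      BeurlingFourier.gelfandSpectrum A = Set.range (BeurlingFourier.evalAt A) := by
  have h1 : ∀ π, 1 ≤ ω π := hω.one_le hsymm
  exact ⟨BeurlingFourier.beurlingFourierAlgebra ω hω h1,
    Set.ext fun u => (BeurlingFourier.mem_beurlingFourierSet_iff h1 u).symm,
    BeurlingFourier.isEmbedding_evalAt hω h1,
    BeurlingFourier.gelfandSpectrum_eq_range_evalAt hω h1 hnonexp hsymm⟩
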